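/- **Setting.** Let $G$ be a countable discrete group acting by homeomorphisms on a second countable, locally compact Hausdorff space $X$, let $Y\subset X$ be a clopen set with $GY=X$, and let $N\colon G\to(0,+\infty)$ be a homomorphism. Let $G\boxtimes Y=\{(g,x)\in G\times X : x\in Y,\ gx\in Y\}$, a subgroupoid of the transformation groupoid $G\times X$ (the arrow $(g,x)$ has source $x$ and range $gx$), and let $C^*_r(G\boxtimes Y)$ be its reduced C$^*$-algebra, i.e. the norm closure of the operators $\lambda(f)$, $f\in C_c(G\boxtimes Y)$, of left convolution by $f$ on $\ell^2(G\boxtimes Y)=\bigoplus_{x\in Y}\ell^2(\{(g,x): gx\in Y\})$. It carries the dynamics $\sigma$ determined by $$\sigma_t(f)(g,x)=N(g)^{it}f(g,x)\qquad (t\in\mathbb R,\ f\in C_c(G\boxtimes Y)),$$ and the conditional expectation $E\colon C^*_r(G\boxtimes Y)\to C_0(Y)$ determined by $E(f)(x)=f(e,x)$ for $f\in C_c(G\boxtimes Y)$. For $\beta\in\mathbb R$, a $\sigma$-KMS$_\beta$-state is a $\sigma$-invariant state $\varphi$ such that $\varphi(ab)=\varphi(b\,\sigma_{i\beta}(a))$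 for all $a,b$ in some set of $\sigma$-analytic elements with dense linear span. **Proposition.** Suppose there are a sequence $(Y_n)_{n\ge1}$ of Borel subsets of $Y$ and a sequence $(g_n)_{n\ge1}$ in $G$ such that (i) $\bigcup_n Y_n$ contains all points of $Y$ with nontrivial isotropy, i.e. all $y\in Y$ with $gy=y$ for some $g\neq e$; (ii) $N(g_n)\neq1$ for all $n$; (iii) $g_nY_n=Y_n$ for all $n$. Then for each $\beta\neq0$ the map $\mu\mapsto\varphi=\mu_*\circ E$, that is, $\varphi(a)=\int_Y E(a)\,d\mu$ for $a\in C^*_r(G\boxtimes Y)$, is an affine bijection between the Radon measures $\mu$ on $X$ satisfying $\mu(Y)=1$ and $$\mu(gZ)=N(g)^{-\beta}\mu(Z)\qquad\text{for all } g\in G \text{ and all Borel } Z\subset X,$$ and the $\sigma$-KMS$_\beta$-states $\varphi$ on $C^*_r(G\boxtimes Y)$. -/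

import Mathlib

/-! ## The groupoid `G ⊠ Y` and its reduced C⋆-algebra -/

/-- The groupoid `G ⊠ Y = {(g, x) | x ∈ Y, g x ∈ Y}`, a subgroupoid of the transformation groupoid
`G × X`, with the subspace topology of `G × X`. The arrow `(g, x)` has source `x` and range `g x`,
`(g, h x) (h, x) = (g h, x)` and `(g, x)⁻¹ = (g⁻¹, g x)`. -/
abbrev RestrictedGroupoid (G : Type*) {X : Type*} [Group G] [MulAction G X] (Y : Set X) : Type _ :=
  {p : G × X // p.2 ∈ Y ∧ p.1 • p.2 ∈ Y}

/-- The Hilbert space `ℓ²(I)` of square summable complex families. -/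
abbrev EllTwo (I : Type*) : Type _ := lp (fun _ : I => ℂ) 2

/-- A matrix with bounded entries and a uniformly bounded number of nonzero entries in every row
and every column. -/
def IsBandMatrix {I : Type*} (K : I → I → ℂ) : Prop :=
  ∃ (n : ℕ) (C : ℝ), (∀ a b, ‖K a b‖ ≤ C) ∧
    (∀ a, {b | K a b ≠ 0}.Finite ∧ {b | K a b ≠ 0}.ncard ≤ n) ∧
    (∀ b, {a | K a b ≠ 0}.Finite ∧ {a | K a b ≠ 0}.ncard ≤ n)

theorem IsBandMatrix.exists_bound {I : Type*} {K : I → I → ℂ} (hK : IsBandMatrix K) :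
    ∃ M : ℝ, 0 ≤ M ∧ ∀ (ξ : EllTwo I) (s : Finset I),
      ∑ a ∈ s, ‖∑' b, K a b * ξ b‖ ^ (2 : ENNReal).toReal ≤ (M * ‖ξ‖) ^ (2 : ENNReal).toReal := by
  classical
  obtain ⟨n, C, hC, hr, hc⟩ := hK
  refine ⟨n * |C|, by positivity, fun ξ s => ?_⟩
  have h2 : (2 : ENNReal).toReal = ((2 : ℕ) : ℝ) := by norm_num
  have hξ : ∀ t : Finset I, ∑ b ∈ t, ‖ξ b‖ ^ 2 ≤ ‖ξ‖ ^ 2 := by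
    intro t
    have := lp.sum_rpow_le_norm_rpow (p := 2) (by norm_num) ξ t
    simpa only [h2, Real.rpow_natCast] using this
  simp only [h2, Real.rpow_natCast]
  let R : I → Finset I := fun a => (hr a).1.toFinset
  have hRmem : ∀ a b, b ∈ R a ↔ K a b ≠ 0 := by intro a b; simp [R]
  have hRcard : ∀ a, (R a).card ≤ n := by
    intro a
    rw [← Set.ncard_eq_toFinset_card _ (hr a).1]
    exact (hr a).2
  have hrow : ∀ a, ‖∑' b, K a b * ξ b‖ ^ 2 ≤ n * |C| ^ 2 * ∑ b ∈ R a, ‖ξ b‖ ^ 2 := by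
    intro a
    have e1 : ∑' b, K a b * ξ b = ∑ b ∈ R a, K a b * ξ b := by
      apply tsum_eq_sum
      intro b hb
      have : K a b = 0 := by
        by_contra h
        exact hb ((hRmem a b).2 h)
      simp [this]
    have e2 : ‖∑' b, K a b * ξ b‖ ≤ ∑ b ∈ R a, |C| * ‖ξ b‖ := by
      rw [e1]
      refine (norm_sum_le _ _).trans (Finset.sum_le_sum fun b _ => ?_)
      rw [norm_mul]
      exact mul_le_mul_of_nonneg_right ((hC a b).trans (le_abs_self C)) (norm_nonneg _)
    calc ‖∑' b, K a b * ξ b‖ ^ 2 ≤ (∑ b ∈ R a, |C| * ‖ξ b‖) ^ 2 :=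
          pow_le_pow_left₀ (norm_nonneg _) e2 2
      _ ≤ (R a).card * ∑ b ∈ R a, (|C| * ‖ξ b‖) ^ 2 := sq_sum_le_card_mul_sum_sq
      _ ≤ n * ∑ b ∈ R a, (|C| * ‖ξ b‖) ^ 2 := by
          apply mul_le_mul_of_nonneg_right
          · exact_mod_cast hRcard a
          · positivity
      _ = n * |C| ^ 2 * ∑ b ∈ R a, ‖ξ b‖ ^ 2 := by
          simp only [mul_pow, ← Finset.mul_sum]
          ring
  have hcol : ∑ a ∈ s, ∑ b ∈ R a, ‖ξ b‖ ^ 2 ≤ n * ‖ξ‖ ^ 2 := by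
    have e1 : ∑ a ∈ s, ∑ b ∈ R a, ‖ξ b‖ ^ 2
        = ∑ b ∈ s.biUnion R, ∑ a ∈ s.filter (fun a => K a b ≠ 0), ‖ξ b‖ ^ 2 := by
      apply Finset.sum_comm'
      intro a b
      simp only [Finset.mem_biUnion, Finset.mem_filter, hRmem]
      exact ⟨fun h => ⟨⟨h.1, h.2⟩, a, h.1, h.2⟩, fun h => h.1⟩
    rw [e1]
    calc _ ≤ ∑ b ∈ s.biUnion R, n * ‖ξ b‖ ^ 2 := by
          refine Finset.sum_le_sum fun b _ => ?_
          rw [Finset.sum_const, nsmul_eq_mul]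
          apply mul_le_mul_of_nonneg_right _ (by positivity)
          have : (s.filter (fun a => K a b ≠ 0)).card ≤ {a | K a b ≠ 0}.ncard := by
            rw [← Set.ncard_coe_finset]
            apply Set.ncard_le_ncard _ (hc b).1
            intro a ha
            simpa using (Finset.mem_filter.1 (Finset.mem_coe.1 ha)).2
          exact_mod_cast this.trans (hc b).2
      _ = n * ∑ b ∈ s.biUnion R, ‖ξ b‖ ^ 2 := by rw [Finset.mul_sum]
      _ ≤ n * ‖ξ‖ ^ 2 := by gcongr; exact hξ _
  calc ∑ a ∈ s, ‖∑' b, K a b * ξ b‖ ^ 2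
      ≤ ∑ a ∈ s, n * |C| ^ 2 * ∑ b ∈ R a, ‖ξ b‖ ^ 2 := Finset.sum_le_sum fun a _ => hrow a
    _ = n * |C| ^ 2 * ∑ a ∈ s, ∑ b ∈ R a, ‖ξ b‖ ^ 2 := by rw [Finset.mul_sum]
    _ ≤ n * |C| ^ 2 * (n * ‖ξ‖ ^ 2) := by gcongr
    _ = (n * |C| * ‖ξ‖) ^ 2 := by ring

theorem IsBandMatrix.summable {I : Type*} {K : I → I → ℂ} (hK : IsBandMatrix K) (a : I)
    (ξ : I → ℂ) : Summable fun b => K a b * ξ b := by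
  obtain ⟨n, C, _, hr, _⟩ := hK
  apply summable_of_hasFiniteSupport
  refine (hr a).1.subset fun b hb => ?_
  simp only [Function.mem_support, ne_eq, mul_eq_zero, not_or] at hb
  exact hb.1

/-- The bounded operator on `ℓ²(I)` given by a band matrix `K`: `(K ξ)(a) = ∑_b K(a, b) ξ(b)`. -/
noncomputable def IsBandMatrix.operator {I : Type*} {K : I → I → ℂ} (hK : IsBandMatrix K) :
    EllTwo I →L[ℂ] EllTwo I :=
  LinearMap.mkContinuousOfExistsBound
    { toFun := fun ξ => ⟨fun a => ∑' b, K a b * ξ b, by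
        obtain ⟨M, _, h⟩ := hK.exists_bound
        exact memℓp_gen' (h ξ)⟩
      map_add' := fun ξ η => by
        ext a
        simp only [lp.coeFn_add, Pi.add_apply, mul_add]
        exact (hK.summable a ξ).tsum_add (hK.summable a η)
      map_smul' := fun c ξ => by
        ext a
        simp only [lp.coeFn_smul, Pi.smul_apply, smul_eq_mul, RingHom.id_apply]
        rw [← tsum_mul_left]
        exact tsum_congr fun b => by ring }
    (by
      obtain ⟨M, hM, h⟩ := hK.exists_bound
      exact ⟨M, fun ξ => lp.norm_le_of_forall_sum_le (by norm_num)
        (mul_nonneg hM (norm_nonneg _)) (h ξ)⟩)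

theorem IsBandMatrix.operator_apply {I : Type*} {K : I → I → ℂ} (hK : IsBandMatrix K)
    (ξ : EllTwo I) (a : I) : hK.operator ξ a = ∑' b, K a b * ξ b := rfl

namespace RestrictedGroupoid

open scoped CompactlySupported

section Algebra

variable {G X : Type*} [Group G] [MulAction G X] {Y : Set X}

/-- The arrow `a b⁻¹ = (k h⁻¹, h x)` for two arrows `a = (k, x)` and `b = (h, x)` with the same
source `x`. -/
def mulInv (a b : RestrictedGroupoid G Y) (h : a.1.2 = b.1.2) : RestrictedGroupoid G Y :=
  ⟨(a.1.1 * b.1.1⁻¹, b.1.1 • b.1.2), b.2.2, by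
    have := a.2.2
    rw [h] at this
    simpa [mul_smul] using this⟩

/-- The unit of the groupoid at the point `x ∈ Y`. -/
def unitAt (G : Type*) {X : Type*} [Group G] [MulAction G X] {Y : Set X} (x : Y) :
    RestrictedGroupoid G Y :=
  ⟨((1 : G), (x : X)), x.2, by simp⟩

open Classical in
/-- The matrix of left convolution by `f`: the entry at `(a, b)` is `f (a b⁻¹)` if `a` and `b`
have the same source and `0` otherwise. -/
noncomputable def convMatrix (f : RestrictedGroupoid G Y → ℂ) (a b : RestrictedGroupoid G Y) : ℂ :=
  if h : a.1.2 = b.1.2 then f (mulInv a b h) else 0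

variable [TopologicalSpace G] [DiscreteTopology G] [TopologicalSpace X]

theorem isBandMatrix_convMatrix (f : C_c(RestrictedGroupoid G Y, ℂ)) :
    IsBandMatrix (convMatrix (Y := Y) f) := by
  classical
  have hcpt : IsCompact (tsupport f) := f.hasCompactSupport
  have hcont : Continuous fun γ : RestrictedGroupoid G Y => γ.1.1 :=
    continuous_fst.comp continuous_subtype_val
  have hfin : ((fun γ : RestrictedGroupoid G Y => γ.1.1) '' tsupport f).Finite :=
    (hcpt.image hcont).finite_of_discrete
  obtain ⟨C, hC⟩ := (f.continuous.norm.bddAbove_range_of_hasCompactSupport f.hasCompactSupport.norm)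
  have hC' : ∀ γ, ‖f γ‖ ≤ C := fun γ => hC ⟨γ, rfl⟩
  set F := (fun γ : RestrictedGroupoid G Y => γ.1.1) '' tsupport f with hF
  have key : ∀ a b, convMatrix (Y := Y) f a b ≠ 0 → a.1.2 = b.1.2 ∧ a.1.1 * b.1.1⁻¹ ∈ F := by
    intro a b hab
    unfold convMatrix at hab
    split_ifs at hab with h
    · exact ⟨h, mulInv a b h, subset_tsupport _ hab, rfl⟩
    · exact absurd rfl hab
  refine ⟨F.ncard, |C|, fun a b => ?_, fun a => ?_, fun b => ?_⟩
  · unfold convMatrix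
    split_ifs with h
    · exact (hC' _).trans (le_abs_self C)
    · simp
  · have hmaps : Set.MapsTo (fun b : RestrictedGroupoid G Y => a.1.1 * b.1.1⁻¹)
        {b | convMatrix (Y := Y) f a b ≠ 0} F := fun b hb => (key a b hb).2
    have hinj : Set.InjOn (fun b : RestrictedGroupoid G Y => a.1.1 * b.1.1⁻¹)
        {b | convMatrix (Y := Y) f a b ≠ 0} := by
      intro b hb c hc hbc
      have h1 : b.1.1 = c.1.1 := by simpa using hbc
      exact Subtype.ext (Prod.ext h1 ((key a b hb).1.symm.trans (key a c hc).1))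
    exact ⟨Set.Finite.of_injOn hmaps hinj hfin, Set.ncard_le_ncard_of_injOn _ hmaps hinj hfin⟩
  · have hmaps : Set.MapsTo (fun a : RestrictedGroupoid G Y => a.1.1 * b.1.1⁻¹)
        {a | convMatrix (Y := Y) f a b ≠ 0} F := fun a ha => (key a b ha).2
    have hinj : Set.InjOn (fun a : RestrictedGroupoid G Y => a.1.1 * b.1.1⁻¹)
        {a | convMatrix (Y := Y) f a b ≠ 0} := by
      intro a ha c hc hac
      have h1 : a.1.1 = c.1.1 := by simpa using hac
      exact Subtype.ext (Prod.ext h1 ((key a b ha).1.trans (key c b hc).1.symm))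
    exact ⟨Set.Finite.of_injOn hmaps hinj hfin, Set.ncard_le_ncard_of_injOn _ hmaps hinj hfin⟩

/-- The operator `λ(f)` of left convolution by `f ∈ C_c(G ⊠ Y)` on `ℓ²(G ⊠ Y)`,
`(λ(f) ξ)(a) = ∑_b f(a b⁻¹) ξ(b)`, the sum over all arrows `b` with the same source as `a`.
As `ℓ²(G ⊠ Y)` is the direct sum over `x ∈ Y` of the spaces `ℓ²` of the arrows with source `x`,
`λ` is the direct sum of the regular representations of the groupoid over all its units. -/
noncomputable def regRep (f : C_c(RestrictedGroupoid G Y, ℂ)) :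
    EllTwo (RestrictedGroupoid G Y) →L[ℂ] EllTwo (RestrictedGroupoid G Y) :=
  (isBandMatrix_convMatrix f).operator

theorem regRep_apply (f : C_c(RestrictedGroupoid G Y, ℂ)) (ξ : EllTwo (RestrictedGroupoid G Y))
    (a : RestrictedGroupoid G Y) : regRep f ξ a = ∑' b, convMatrix (Y := Y) f a b * ξ b := rfl

end Algebra

end RestrictedGroupoid

/-- The reduced C⋆-algebra `C⋆_r(G ⊠ Y)`: the norm closed ⋆-subalgebra of `B(ℓ²(G ⊠ Y))` generated
by the operators `λ(f)`, `f ∈ C_c(G ⊠ Y)`. (Convolution operators of compactly supported continuous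
functions are closed under products and adjoints when `Y` is clopen, so that this is the completion
of `C_c(G ⊠ Y)` in the reduced norm.) -/
noncomputable def ReducedCStar (G : Type*) {X : Type*} [Group G] [TopologicalSpace G]
    [DiscreteTopology G] [TopologicalSpace X] [MulAction G X] (Y : Set X) :
    NonUnitalStarSubalgebra ℂ
      (EllTwo (RestrictedGroupoid G Y) →L[ℂ] EllTwo (RestrictedGroupoid G Y)) :=
  (NonUnitalStarAlgebra.adjoin ℂ
    (Set.range (RestrictedGroupoid.regRep (G := G) (Y := Y)))).topologicalClosure

/-- Conjugation `a ↦ u a u⋆` by a unitary `u`. -/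
noncomputable def conjBy {B : Type*} [NormedRing B] [StarRing B] [NormedAlgebra ℂ B] (u : unitary B) :
    B →⋆ₙₐ[ℂ] B where
  toFun a := u.1 * a * star u.1
  map_smul' c a := by simp
  map_zero' := by simp
  map_add' a b := by simp [mul_add, add_mul]
  map_mul' a b := by
    have h : star u.1 * u.1 = 1 := Unitary.star_mul_self_of_mem u.2
    calc u.1 * (a * b) * star u.1 = u.1 * a * 1 * (b * star u.1) := by simp [mul_assoc]
      _ = u.1 * a * star u.1 * (u.1 * b * star u.1) := by rw [← h]; simp only [mul_assoc]
  map_star' a := by simp [mul_assoc]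

theorem conjBy_apply {B : Type*} [NormedRing B] [StarRing B] [NormedAlgebra ℂ B] (u : unitary B)
    (a : B) : conjBy u a = u.1 * a * star u.1 := rfl

theorem continuous_conjBy {B : Type*} [NormedRing B] [StarRing B] [NormedAlgebra ℂ B]
    (u : unitary B) : Continuous (conjBy u) :=
  (continuous_const.mul continuous_id).mul continuous_const

/-- The restriction of a ⋆-homomorphism to an invariant ⋆-subalgebra. -/
noncomputable def restrictHom {B : Type*} [NormedRing B] [StarRing B] [NormedAlgebra ℂ B]
    (S : NonUnitalStarSubalgebra ℂ B) (θ : B →⋆ₙₐ[ℂ] B) (h : S ≤ S.comap θ) : S →⋆ₙₐ[ℂ] S where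
  toFun a := ⟨θ a, h a.2⟩
  map_smul' c a := Subtype.ext (map_smul θ c (a : B))
  map_zero' := Subtype.ext (map_zero θ)
  map_add' a b := Subtype.ext (map_add θ (a : B) b)
  map_mul' a b := Subtype.ext (map_mul θ (a : B) b)
  map_star' a := Subtype.ext (map_star θ (a : B))

section Structure

open scoped CompactlySupported

variable {G X : Type*} [Group G] [MulAction G X] {Y : Set X}

/-- The phase `N(h)^{it}` at an arrow `(h, x)`. -/
noncomputable def phase (N : G →* {r : ℝ // 0 < r}) (t : ℝ) (a : RestrictedGroupoid G Y) : ℂ :=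
  ((N a.1.1 : ℝ) : ℂ) ^ (Complex.I * t)

theorem norm_phase (N : G →* {r : ℝ // 0 < r}) (t : ℝ) (a : RestrictedGroupoid G Y) :
    ‖phase N t a‖ = 1 := by
  unfold phase
  rw [Complex.norm_cpow_eq_rpow_re_of_pos (N a.1.1).2]
  simp

variable (Y) in
/-- Multiplication by `N(h)^{it}` on `ℓ²(G ⊠ Y)`. -/
noncomputable def phaseIsometry (N : G →* {r : ℝ // 0 < r}) (t : ℝ) :
    EllTwo (RestrictedGroupoid G Y) →ₗᵢ[ℂ] EllTwo (RestrictedGroupoid G Y) where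
  toFun ξ := ⟨fun a => phase N t a * ξ a, by
    refine (lp.memℓp ξ).mono' (fun a => ?_)
    simp [norm_phase]⟩
  map_add' ξ η := by
    ext a
    exact mul_add _ _ _
  map_smul' c ξ := by
    ext a
    simp only [lp.coeFn_smul, Pi.smul_apply, smul_eq_mul, RingHom.id_apply]
    ring
  norm_map' ξ := by
    rw [lp.norm_eq_tsum_rpow (by norm_num), lp.norm_eq_tsum_rpow (by norm_num)]
    simp [norm_phase]

variable (Y) in
/-- The unitary operator `U_t` of multiplication by `N(h)^{it}` on `ℓ²(G ⊠ Y)`. -/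
noncomputable def phaseUnitary (N : G →* {r : ℝ // 0 < r}) (t : ℝ) :
    unitary (EllTwo (RestrictedGroupoid G Y) →L[ℂ] EllTwo (RestrictedGroupoid G Y)) :=
  Unitary.linearIsometryEquiv.symm
    (LinearIsometryEquiv.ofSurjective (phaseIsometry Y N t) (fun ξ => by
      refine ⟨phaseIsometry Y N (-t) ξ, ?_⟩
      ext a
      change phase N t a * (phase N (-t) a * ξ a) = ξ a
      rw [← mul_assoc]
      unfold phase
      rw [← Complex.cpow_add _ _ (by exact_mod_cast (N a.1.1).2.ne')]
      simp))

theorem phaseUnitary_apply (N : G →* {r : ℝ // 0 < r}) (t : ℝ)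
    (ξ : EllTwo (RestrictedGroupoid G Y)) (a : RestrictedGroupoid G Y) :
    (phaseUnitary Y N t).1 ξ a = phase N t a * ξ a := rfl

variable [TopologicalSpace G] [DiscreteTopology G] [TopologicalSpace X]

/-- The element of `C⋆_r(G ⊠ Y)` given by `f ∈ C_c(G ⊠ Y)`. -/
noncomputable def ReducedCStar.ofFun (f : C_c(RestrictedGroupoid G Y, ℂ)) : ReducedCStar G Y :=
  ⟨RestrictedGroupoid.regRep f, NonUnitalStarSubalgebra.le_topologicalClosure _
    (NonUnitalStarAlgebra.subset_adjoin ℂ _ ⟨f, rfl⟩)⟩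

/-! ### The dynamics -/

theorem continuous_phase (N : G →* {r : ℝ // 0 < r}) (t : ℝ) :
    Continuous (phase (Y := Y) N t) :=
  (continuous_of_discreteTopology (f := fun g : G => ((N g : ℝ) : ℂ) ^ (Complex.I * t))).comp
    (continuous_fst.comp continuous_subtype_val)

/-- The function `(g, x) ↦ N(g)^{it} f(g, x)`. -/
noncomputable def phaseMul (N : G →* {r : ℝ // 0 < r}) (t : ℝ)
    (f : C_c(RestrictedGroupoid G Y, ℂ)) : C_c(RestrictedGroupoid G Y, ℂ) where
  toFun a := phase N t a * f a
  continuous_toFun := (continuous_phase N t).mul f.continuous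
  hasCompactSupport' := f.hasCompactSupport.mul_left

theorem phaseUnitary_mul_regRep (N : G →* {r : ℝ // 0 < r}) (t : ℝ)
    (f : C_c(RestrictedGroupoid G Y, ℂ)) :
    (phaseUnitary Y N t).1 * RestrictedGroupoid.regRep f
      = RestrictedGroupoid.regRep (phaseMul N t f) * (phaseUnitary Y N t).1 := by
  ext ξ a
  change phase N t a * (∑' b, RestrictedGroupoid.convMatrix (Y := Y) f a b * ξ b)
    = ∑' b, RestrictedGroupoid.convMatrix (Y := Y) (phaseMul N t f) a b * (phase N t b * ξ b)
  rw [← tsum_mul_left]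
  refine tsum_congr fun b => ?_
  unfold RestrictedGroupoid.convMatrix
  split_ifs with h
  · change phase N t a * (f (a.mulInv b h) * ξ b)
      = (phase N t (a.mulInv b h) * f (a.mulInv b h)) * (phase N t b * ξ b)
    have hab : phase N t a = phase N t (a.mulInv b h) * phase N t b := by
      unfold phase
      rw [← Complex.mul_cpow_ofReal_nonneg (N _).2.le (N _).2.le, ← Complex.ofReal_mul]
      congr 2
      have : N a.1.1 = N (a.mulInv b h).1.1 * N b.1.1 := by
        rw [← map_mul]
        simp [RestrictedGroupoid.mulInv]
      rw [this]
      rfl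
    rw [hab]
    ring
  · simp

theorem conj_regRep (N : G →* {r : ℝ // 0 < r}) (t : ℝ) (f : C_c(RestrictedGroupoid G Y, ℂ)) :
    conjBy (phaseUnitary Y N t) (RestrictedGroupoid.regRep f)
      = RestrictedGroupoid.regRep (phaseMul N t f) := by
  rw [conjBy_apply, phaseUnitary_mul_regRep, mul_assoc, Unitary.mul_star_self_of_mem
    (phaseUnitary Y N t).2, mul_one]

theorem conj_mem (N : G →* {r : ℝ // 0 < r}) (t : ℝ) :
    ReducedCStar G Y ≤ (ReducedCStar G Y).comap (conjBy (phaseUnitary Y N t)) := by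
  refine NonUnitalStarSubalgebra.topologicalClosure_minimal _
    (NonUnitalStarAlgebra.adjoin_le ?_)
    ((NonUnitalStarSubalgebra.isClosed_topologicalClosure _).preimage (continuous_conjBy _))
  rintro _ ⟨f, rfl⟩
  rw [SetLike.mem_coe, NonUnitalStarSubalgebra.mem_comap, conj_regRep]
  exact (ReducedCStar.ofFun (phaseMul N t f)).2

/-- The dynamics `σ` on `C⋆_r(G ⊠ Y)` associated with `N`: `σ_t(a) = U_t a U_t⋆`. It is the
continuous extension of `σ_t(f)(g, x) = N(g)^{it} f(g, x)`, see `dynamics_ofFun`. -/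
noncomputable def dynamics (Y : Set X) (N : G →* {r : ℝ // 0 < r}) (t : ℝ) :
    ReducedCStar G Y →⋆ₙₐ[ℂ] ReducedCStar G Y :=
  restrictHom (ReducedCStar G Y) (conjBy (phaseUnitary Y N t)) (conj_mem N t)

theorem dynamics_ofFun (N : G →* {r : ℝ // 0 < r}) (t : ℝ) (f : C_c(RestrictedGroupoid G Y, ℂ)) :
    dynamics Y N t (ReducedCStar.ofFun f) = ReducedCStar.ofFun (phaseMul N t f) :=
  Subtype.ext (conj_regRep N t f)

/-! ### The conditional expectation -/

open Classical in
/-- The conditional expectation `E` of `C⋆_r(G ⊠ Y)` onto `C₀(Y)`, with `E(a)` given as a function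
on `Y`: `E(a)(x) = ⟨δ_{(e,x)}, a δ_{(e,x)}⟩` is the diagonal entry of `a` at the unit over `x`. It is
the continuous extension of the restriction of `f ∈ C_c(G ⊠ Y)` to the unit space `Y`, see
`condExpect_ofFun`; in other words `E(f u_g) = f` if `g = e` and `0` otherwise. -/
noncomputable def condExpect (a : ReducedCStar G Y) (x : Y) : ℂ :=
  (a : EllTwo (RestrictedGroupoid G Y) →L[ℂ] EllTwo (RestrictedGroupoid G Y))
    (lp.single 2 (RestrictedGroupoid.unitAt G x) (1 : ℂ)) (RestrictedGroupoid.unitAt G x)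

theorem condExpect_ofFun (f : C_c(RestrictedGroupoid G Y, ℂ)) (x : Y) :
    condExpect (ReducedCStar.ofFun f) x = f (RestrictedGroupoid.unitAt G x) := by
  classical
  unfold condExpect
  change ∑' b, RestrictedGroupoid.convMatrix (Y := Y) f _ b * _ = _
  rw [tsum_eq_single (RestrictedGroupoid.unitAt G x)]
  · rw [lp.single_apply_self]
    simp [RestrictedGroupoid.convMatrix, RestrictedGroupoid.mulInv, RestrictedGroupoid.unitAt]
  · intro b hb
    rw [lp.single_apply_ne _ _ _ hb, mul_zero]

theorem norm_condExpect_le (a : ReducedCStar G Y) (x : Y) : ‖condExpect a x‖ ≤ ‖a‖ := by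
  classical
  unfold condExpect
  refine (lp.norm_apply_le_norm (by norm_num) _ _).trans ?_
  refine (ContinuousLinearMap.le_opNorm _ _).trans ?_
  rw [lp.norm_single (by norm_num)]
  simp

end Structure

/-! ## States and KMS states -/

section KMS

open scoped ComplexOrder

variable {A : Type*} [NonUnitalCStarAlgebra A]

/-- States of a (not necessarily unital) C⋆-algebra: positive linear functionals of norm one. -/
def IsCStarState (φ : A →L[ℂ] ℂ) : Prop :=
  (∀ a : A, 0 ≤ φ (star a * a)) ∧ ‖φ‖ = 1

/-- `F` is the entire extension `z ↦ σ_z(a)` of the orbit `t ↦ σ_t(a)`; an element `a` is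
`σ`-analytic if it has such an extension, which is then unique. -/
def IsEntireOrbit (σ : ℝ → A → A) (a : A) (F : ℂ → A) : Prop :=
  Differentiable ℂ F ∧ ∀ t : ℝ, F (t : ℂ) = σ t a

/-- `σ`-KMS states at inverse temperature `β`: `σ`-invariant states `φ` such that
`φ(ab) = φ(b σ_{iβ}(a))` for `a` and `b` in a set of `σ`-analytic elements with dense linear
span. -/
def IsKMSState (σ : ℝ → A → A) (β : ℝ) (φ : A →L[ℂ] ℂ) : Prop :=
  IsCStarState φ ∧ (∀ (t : ℝ) (a : A), φ (σ t a) = φ a) ∧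
    ∃ S : Set A, Dense (Submodule.span ℂ S : Set A) ∧
      ∀ a ∈ S, ∃ F : ℂ → A, IsEntireOrbit σ a F ∧
        ∀ b ∈ S, φ (a * b) = φ (b * F (Complex.I * β))

end KMS

noncomputable instance ReducedCStar.instNonUnitalCStarAlgebra {G X : Type*} [Group G]
    [TopologicalSpace G] [DiscreteTopology G] [TopologicalSpace X] [MulAction G X] (Y : Set X) :
    NonUnitalCStarAlgebra (ReducedCStar G Y) :=
  haveI : IsClosed (ReducedCStar G Y : Set (EllTwo (RestrictedGroupoid G Y) →L[ℂ]
      EllTwo (RestrictedGroupoid G Y))) :=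
    NonUnitalStarSubalgebra.isClosed_topologicalClosure _
  NonUnitalStarSubalgebra.nonUnitalCStarAlgebra (ReducedCStar G Y)

/-! ## Measures -/

open scoped Pointwise in
/-- Radon measures `μ` on `X` with `μ(Y) = 1` and `μ(gZ) = N(g)^{-β} μ(Z)` for all `g ∈ G` and all
Borel sets `Z ⊆ X`. -/
structure IsNormalizedScalingMeasure {G X : Type*} [Group G] [TopologicalSpace X]
    [MeasurableSpace X] [MulAction G X] (Y : Set X) (N : G →* {r : ℝ // 0 < r}) (β : ℝ)
    (μ : MeasureTheory.Measure X) : Prop where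
  radon : μ.Regular
  normalized : μ Y = 1
  scaling : ∀ (g : G) (Z : Set X), MeasurableSet Z →
    μ (g • Z) = ENNReal.ofReal ((N g : ℝ) ^ (-β)) * μ Z

/-!
The map `μ ↦ μ ∘ E` is built, shown to be injective and shown to be surjective, as a statement about
any C⋆-algebra `A` that is spanned densely by elements `u_g F`, `g ∈ G`, `F ∈ C_c(X)`, multiplying
as in the groupoid algebra of `G ⊠ Y` (`SliceSystem`). The reduced C⋆-algebra is such an algebra
because every `f ∈ C_c(G ⊠ Y)` is a finite sum of functions supported on slices `{g} × X`.

*From measures to states.* For `a = u_g F` and `b = u_h H` both sides of the KMS relation for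
`μ ∘ E` vanish unless `h = g⁻¹`, and then the relation is the change of variables `y = g x`
(`SliceSystem.isKMSState_integralFunctional`). The state determines `μ` on `Y`, and then scaling and
`G Y = X` determine `μ` on `X` (`measure_eq_of_scaling`).

*From states to measures.* Let `φ` be a KMS state. The definition only gives the KMS relation for some
set of analytic elements, but it follows for all `a = u_g F`, which are eigenvectors of the dynamics
(`IsKMSState.apply_mul_of_eigenvector`, by Cauchy's theorem on long rectangles). The Riesz–Markov
theorem represents `φ` on `C_c(X)` by a finite measure `μ₀` living on `Y`, and the KMS relation for
`u_g F` and `u_{g⁻¹} H` says that `μ₀` scales under the partial action of `G` on `Y`. Hence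
`μ₀(Yₙ) = N(gₙ)^{-β} μ₀(Yₙ)`, so that `μ₀(Yₙ) = 0`, and the fixed points of every `g ≠ e` form a
`μ₀`-null set. This forces `φ(u_g F) = 0` for `g ≠ e`: the KMS relation with functions in `C_c(X)`,
which are fixed by the dynamics, gives it for `F` supported away from the fixed points, and the
Cauchy–Schwarz inequality `|φ(u_g F)|² ≤ C ∫ |F|² dμ₀` makes the contribution of a small
neighbourhood of the fixed points negligible (`SliceSystem.apply_elt_eq_zero_of_null`). So
`φ = μ₀ ∘ E`, and `μ₀` extends to a scaling measure on `X` (`exists_scaling_extension`).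
-/

section ReducedAlgebra

open scoped CompactlySupported Pointwise

/-! ### Coefficient functions of products and adjoints -/

section Coefficients

variable {G X : Type*} [Group G] [TopologicalSpace X] [MulAction G X] [ContinuousConstSMul G X]
  {Y : Set X}

/-- The function `y ↦ F(h y) 1_Y(h y) H(y)`, the coefficient of the product of slices
`u_g F · u_h H`. -/
noncomputable def sliceMul (hY : IsClopen Y) (F : C_c(X, ℂ)) (h : G) (H : C_c(X, ℂ)) :
    C_c(X, ℂ) where
  toFun y := Set.indicator Y F (h • y) * H y
  continuous_toFun := ((hY.continuous_indicator F.continuous).comp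
    (continuous_const_smul h)).mul H.continuous
  hasCompactSupport' := H.hasCompactSupport.mul_left

theorem sliceMul_apply (hY : IsClopen Y) (F : C_c(X, ℂ)) (h : G) (H : C_c(X, ℂ)) (y : X) :
    sliceMul hY F h H y = Set.indicator Y F (h • y) * H y := rfl

variable [T2Space X]

/-- The function `y ↦ conj F(g⁻¹ y) 1_Y(g⁻¹ y)`, the coefficient of the adjoint of `u_g F`. -/
noncomputable def sliceStar (hY : IsClopen Y) (g : G) (F : C_c(X, ℂ)) : C_c(X, ℂ) where
  toFun y := star (Set.indicator Y F (g⁻¹ • y))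
  continuous_toFun := ((hY.continuous_indicator F.continuous).comp
    (continuous_const_smul g⁻¹)).star
  hasCompactSupport' := by
    refine HasCompactSupport.intro (F.hasCompactSupport.image (continuous_const_smul g)) ?_
    intro y hy
    have : F (g⁻¹ • y) = 0 := by
      by_contra h
      exact hy ⟨g⁻¹ • y, subset_tsupport _ h, by simp⟩
    simp [Set.indicator, this]

theorem sliceStar_apply (hY : IsClopen Y) (g : G) (F : C_c(X, ℂ)) (y : X) :
    sliceStar hY g F y = star (Set.indicator Y F (g⁻¹ • y)) := rfl

end Coefficients

/-! ### Functions supported on one slice of the groupoid -/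

section Slice

open RestrictedGroupoid

variable {G X : Type*} [Group G] [TopologicalSpace G] [DiscreteTopology G] [TopologicalSpace X]
  [MulAction G X] {Y : Set X}

theorem regRep_add (f₁ f₂ : C_c(RestrictedGroupoid G Y, ℂ)) :
    regRep (f₁ + f₂) = regRep f₁ + regRep f₂ := by
  ext ξ a
  change ∑' b, convMatrix (Y := Y) (f₁ + f₂) a b * ξ b
    = (∑' b, convMatrix (Y := Y) f₁ a b * ξ b) + ∑' b, convMatrix (Y := Y) f₂ a b * ξ b
  rw [← ((isBandMatrix_convMatrix f₁).summable a ξ).tsum_add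
    ((isBandMatrix_convMatrix f₂).summable a ξ)]
  refine tsum_congr fun b => ?_
  unfold convMatrix
  split_ifs <;> simp [add_mul]

theorem regRep_smul (c : ℂ) (f : C_c(RestrictedGroupoid G Y, ℂ)) :
    regRep (c • f) = c • regRep f := by
  ext ξ a
  change ∑' b, convMatrix (Y := Y) (c • f) a b * ξ b
    = c * (∑' b, convMatrix (Y := Y) f a b * ξ b)
  rw [← tsum_mul_left]
  refine tsum_congr fun b => ?_
  unfold convMatrix
  split_ifs <;> simp [mul_assoc]

open Classical in
theorem regRep_single (f : C_c(RestrictedGroupoid G Y, ℂ)) (a b : RestrictedGroupoid G Y) :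
    regRep f (lp.single 2 b (1 : ℂ)) a = convMatrix (Y := Y) f a b := by
  rw [regRep_apply, tsum_eq_single b]
  · simp
  · intro c hc
    rw [lp.single_apply_ne _ _ _ hc, mul_zero]

/-- `f ↦ λ(f)` as a linear map. -/
noncomputable def regRepₗ : C_c(RestrictedGroupoid G Y, ℂ) →ₗ[ℂ]
    EllTwo (RestrictedGroupoid G Y) →L[ℂ] EllTwo (RestrictedGroupoid G Y) where
  toFun := regRep
  map_add' := regRep_add
  map_smul' := regRep_smul

/-- `f ↦ λ(f)` as a linear map into the reduced C⋆-algebra. -/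
noncomputable def ReducedCStar.ofFunₗ :
    C_c(RestrictedGroupoid G Y, ℂ) →ₗ[ℂ] ReducedCStar G Y where
  toFun := ReducedCStar.ofFun
  map_add' f₁ f₂ := Subtype.ext (regRep_add f₁ f₂)
  map_smul' c f := Subtype.ext (regRep_smul c f)

open Classical in
/-- The extension by zero of a function on `G ⊠ Y` to `G × X`. -/
noncomputable def extendZero (ξ : RestrictedGroupoid G Y → ℂ) (g : G) (x : X) : ℂ :=
  if h : x ∈ Y ∧ g • x ∈ Y then ξ ⟨(g, x), h⟩ else 0

variable [ContinuousConstSMul G X]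

theorem isClosedEmbedding_restrictedGroupoid (hY : IsClopen Y) :
    Topology.IsClosedEmbedding (Subtype.val : RestrictedGroupoid G Y → G × X) := by
  apply Topology.IsClosedEmbedding.subtypeVal
  have h : Continuous fun p : G × X => p.1 • p.2 := by
    rw [continuous_prod_of_discrete_left]
    exact fun g => continuous_const_smul g
  exact (hY.1.preimage continuous_snd).inter (hY.1.preimage h)

variable [T2Space X]

open Classical in
/-- The function on `G ⊠ Y` that is supported on the slice `{g} × X` and is given there by
`F ∈ C_c(X)`, as a function of the source. In the usual notation it is `u_g F`. -/
noncomputable def slice (hY : IsClopen Y) (g : G) (F : C_c(X, ℂ)) :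
    C_c(RestrictedGroupoid G Y, ℂ) where
  toFun p := if p.1.1 = g then F p.1.2 else 0
  continuous_toFun := by
    have h : Continuous fun p : G × X => if p.1 = g then F p.2 else 0 := by
      rw [continuous_prod_of_discrete_left]
      intro k
      by_cases hk : k = g
      · simpa [hk] using F.continuous
      · simpa [hk] using continuous_const
    exact h.comp continuous_subtype_val
  hasCompactSupport' := by
    refine HasCompactSupport.intro ((isClosedEmbedding_restrictedGroupoid (G := G)
      hY).isCompact_preimage (isCompact_singleton (x := g) |>.prod F.hasCompactSupport)) ?_
    intro p hp
    by_cases hk : p.1.1 = g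
    · simp only [hk, if_true]
      by_contra h
      exact hp ⟨hk, subset_tsupport _ h⟩
    · simp [hk]

open Classical in
theorem slice_apply (hY : IsClopen Y) (g : G) (F : C_c(X, ℂ)) (p : RestrictedGroupoid G Y) :
    slice hY g F p = if p.1.1 = g then F p.1.2 else 0 := rfl

/-- The element `λ(u_g F)` of the reduced C⋆-algebra. -/
noncomputable def sliceElt (hY : IsClopen Y) (g : G) : C_c(X, ℂ) →ₗ[ℂ] ReducedCStar G Y :=
  ReducedCStar.ofFunₗ ∘ₗ
    { toFun := slice hY g
      map_add' := fun F₁ F₂ => by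
        ext p
        simp only [slice_apply, CompactlySupportedContinuousMap.add_apply]
        split_ifs <;> simp
      map_smul' := fun c F => by
        ext p
        simp only [slice_apply, CompactlySupportedContinuousMap.smul_apply, RingHom.id_apply]
        split_ifs <;> simp }

theorem sliceElt_eq (hY : IsClopen Y) (g : G) (F : C_c(X, ℂ)) :
    sliceElt hY g F = ReducedCStar.ofFun (slice hY g F) := rfl

theorem regRep_slice_apply (hY : IsClopen Y) (g : G) (F : C_c(X, ℂ))
    (ξ : EllTwo (RestrictedGroupoid G Y)) (a : RestrictedGroupoid G Y) :
    regRep (slice hY g F) ξ a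
      = F ((g⁻¹ * a.1.1) • a.1.2) * extendZero ξ (g⁻¹ * a.1.1) a.1.2 := by
  classical
  rw [regRep_apply]
  by_cases h : (g⁻¹ * a.1.1) • a.1.2 ∈ Y
  · rw [tsum_eq_single ⟨(g⁻¹ * a.1.1, a.1.2), a.2.1, h⟩]
    · rw [extendZero, dif_pos ⟨a.2.1, h⟩]
      simp [convMatrix, mulInv, slice_apply]
    · rintro ⟨⟨k, x⟩, hb⟩ hne
      rw [mul_eq_zero]
      left
      unfold convMatrix
      split_ifs with h1
      · rw [slice_apply, if_neg]
        intro h2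
        apply hne
        have h3 : a.1.1 * k⁻¹ = g := h2
        have h4 : a.1.2 = x := h1
        simp [← h3, ← h4]
      · rfl
  · rw [extendZero, dif_neg fun h' => h h'.2, mul_zero]
    convert tsum_zero with b
    rw [mul_eq_zero]
    left
    unfold convMatrix
    split_ifs with h1
    · rw [slice_apply, if_neg]
      intro h2
      apply h
      have h3 : a.1.1 * b.1.1⁻¹ = g := h2
      have := b.2.2
      rw [← h1] at this
      simpa [← h3] using this
    · rfl

theorem sliceElt_congr (hY : IsClopen Y) (g : G) {F₁ F₂ : C_c(X, ℂ)}
    (h : ∀ x ∈ Y, g • x ∈ Y → F₁ x = F₂ x) : sliceElt hY g F₁ = sliceElt hY g F₂ := by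
  rw [sliceElt_eq, sliceElt_eq]
  congr 1
  ext p
  rw [slice_apply, slice_apply]
  split_ifs with hp
  · exact h _ p.2.1 (hp ▸ p.2.2)
  · rfl

theorem regRep_slice_mul (hY : IsClopen Y) (g h : G) (F H : C_c(X, ℂ)) :
    regRep (slice hY g F) * regRep (slice hY h H)
      = regRep (slice hY (g * h) (sliceMul hY F h H)) := by
  classical
  ext ξ a
  change regRep (slice hY g F) (regRep (slice hY h H) ξ) a = regRep (slice hY (g * h) _) ξ a
  rw [regRep_slice_apply, regRep_slice_apply, extendZero]
  have e : h • ((g * h)⁻¹ * a.1.1) • a.1.2 = (g⁻¹ * a.1.1) • a.1.2 := by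
    simp [← mul_smul, mul_assoc]
  rw [sliceMul_apply, e]
  split_ifs with h1
  · rw [regRep_slice_apply, Set.indicator_of_mem h1.2]
    simp [mul_assoc]
  · rw [Set.indicator_of_notMem fun h' => h1 ⟨a.2.1, h'⟩]
    simp

theorem sliceElt_mul (hY : IsClopen Y) (g h : G) (F H : C_c(X, ℂ)) :
    sliceElt hY g F * sliceElt hY h H = sliceElt hY (g * h) (sliceMul hY F h H) :=
  Subtype.ext (regRep_slice_mul hY g h F H)

theorem star_regRep_slice (hY : IsClopen Y) (g : G) (F : C_c(X, ℂ)) :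
    star (regRep (slice hY g F)) = regRep (slice hY g⁻¹ (sliceStar hY g F)) := by
  classical
  apply lp.ext_continuousLinearMap (by norm_num)
  intro b
  ext a
  change (star (regRep (slice hY g F))) (lp.single 2 b (1 : ℂ)) a
    = regRep (slice hY g⁻¹ (sliceStar hY g F)) (lp.single 2 b (1 : ℂ)) a
  have h1 := lp.inner_single_left (𝕜 := ℂ) a (1 : ℂ)
    ((star (regRep (slice hY g F))) (lp.single 2 b (1 : ℂ)))
  rw [ContinuousLinearMap.star_eq_adjoint, ContinuousLinearMap.adjoint_inner_right,
    lp.inner_single_right, regRep_single] at h1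
  simp only [RCLike.inner_apply, map_one, mul_one, one_mul] at h1
  rw [ContinuousLinearMap.star_eq_adjoint, ← h1, regRep_single]
  unfold convMatrix
  by_cases hab : a.1.2 = b.1.2
  · rw [dif_pos hab, dif_pos hab.symm, slice_apply, slice_apply]
    change (starRingEnd ℂ) (if b.1.1 * a.1.1⁻¹ = g then F (a.1.1 • a.1.2) else 0)
      = if a.1.1 * b.1.1⁻¹ = g⁻¹ then sliceStar hY g F (b.1.1 • b.1.2) else 0
    have hiff : b.1.1 * a.1.1⁻¹ = g ↔ a.1.1 * b.1.1⁻¹ = g⁻¹ := by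
      rw [← inv_inj]
      simp
    by_cases hg : b.1.1 * a.1.1⁻¹ = g
    · rw [if_pos hg, if_pos (hiff.1 hg), sliceStar_apply]
      have : g⁻¹ • b.1.1 • b.1.2 = a.1.1 • a.1.2 := by
        rw [← hg, ← hab]
        simp [mul_smul]
      rw [this, Set.indicator_of_mem a.2.2]
      rfl
    · rw [if_neg hg, if_neg fun h => hg (hiff.2 h), map_zero]
  · rw [dif_neg hab, dif_neg fun h => hab h.symm, map_zero]

theorem star_sliceElt (hY : IsClopen Y) (g : G) (F : C_c(X, ℂ)) :
    star (sliceElt hY g F) = sliceElt hY g⁻¹ (sliceStar hY g F) :=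
  Subtype.ext (star_regRep_slice hY g F)

theorem exists_sum_slice (hY : IsClopen Y) (f : C_c(RestrictedGroupoid G Y, ℂ)) :
    ∃ (s : Finset G) (F : G → C_c(X, ℂ)), f = ∑ g ∈ s, slice hY g (F g) := by
  classical
  have hcont : Continuous fun γ : RestrictedGroupoid G Y => γ.1.1 :=
    continuous_fst.comp continuous_subtype_val
  have hfin : ((fun γ : RestrictedGroupoid G Y => γ.1.1) '' tsupport f).Finite :=
    (f.hasCompactSupport.image hcont).finite_of_discrete
  have hF : ∀ g : G, ∃ F : C_c(X, ℂ), ∀ x (h : x ∈ Y ∧ g • x ∈ Y), F x = f ⟨(g, x), h⟩ := by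
    intro g
    have hW : IsClopen {x | x ∈ Y ∧ g • x ∈ Y} :=
      hY.inter (hY.preimage (continuous_const_smul g))
    refine ⟨⟨⟨extendZero f g, ?_⟩, ?_⟩, fun x h => ?_⟩
    · rw [continuous_iff_continuousAt]
      intro x
      by_cases hx : x ∈ {x | x ∈ Y ∧ g • x ∈ Y}
      · refine ContinuousOn.continuousAt ?_ (hW.2.mem_nhds hx)
        rw [continuousOn_iff_continuous_domRestrict]
        have : Set.domRestrict {x | x ∈ Y ∧ g • x ∈ Y} (extendZero f g)
            = fun x => f ⟨(g, x.1), x.2⟩ := by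
          ext x
          exact dif_pos x.2
        rw [this]
        exact f.continuous.comp (by fun_prop)
      · refine (continuousAt_const (y := (0 : ℂ))).congr ?_
        filter_upwards [hW.compl.2.mem_nhds hx] with z hz
        have hz' : ¬(z ∈ Y ∧ g • z ∈ Y) := hz
        simp only [extendZero, dif_neg hz']
    · refine HasCompactSupport.intro (f.hasCompactSupport.image
        (continuous_snd.comp continuous_subtype_val)) ?_
      intro x hx
      by_contra h
      have h' : extendZero f g x ≠ 0 := h
      unfold extendZero at h'
      split_ifs at h' with hxW
      · exact hx ⟨_, subset_tsupport _ h', rfl⟩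
      · exact h' rfl
    · exact dif_pos h
  choose F hF using hF
  refine ⟨hfin.toFinset, F, ?_⟩
  ext p
  rw [CompactlySupportedContinuousMap.sum_apply]
  simp only [slice_apply]
  rw [Finset.sum_ite_eq]
  split_ifs with hp
  · exact (hF _ _ p.2).symm
  · by_contra h
    exact hp (hfin.mem_toFinset.2 ⟨p, subset_tsupport _ h, rfl⟩)

theorem regRep_mem_span_slice (hY : IsClopen Y) (f : C_c(RestrictedGroupoid G Y, ℂ)) :
    regRep f ∈ Submodule.span ℂ {a | ∃ (g : G) (F : C_c(X, ℂ)), regRep (slice hY g F) = a} := by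
  obtain ⟨s, F, rfl⟩ := exists_sum_slice hY f
  change regRepₗ _ ∈ _
  rw [map_sum]
  exact Submodule.sum_mem _ fun g _ => Submodule.subset_span ⟨g, F g, rfl⟩

/-- The span of the operators `λ(u_g F)` contains all `λ(f)` and is closed under products and
adjoints, so that it contains the ⋆-algebra generated by the `λ(f)`. -/
theorem adjoin_le_span_slice (hY : IsClopen Y)
    {x : EllTwo (RestrictedGroupoid G Y) →L[ℂ] EllTwo (RestrictedGroupoid G Y)}
    (hx : x ∈ NonUnitalStarAlgebra.adjoin ℂ (Set.range (regRep (G := G) (Y := Y)))) :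
    x ∈ Submodule.span ℂ {a | ∃ (g : G) (F : C_c(X, ℂ)), regRep (slice hY g F) = a} := by
  set M := Submodule.span ℂ {a | ∃ (g : G) (F : C_c(X, ℂ)), regRep (slice hY g F) = a} with hM
  induction hx using NonUnitalStarAlgebra.adjoin_induction with
  | mem x hx =>
    obtain ⟨f, rfl⟩ := hx
    exact regRep_mem_span_slice hY f
  | add x y _ _ hx hy => exact M.add_mem hx hy
  | zero => exact M.zero_mem
  | mul x y _ _ hx hy =>
    have := Submodule.mul_mem_mul hx hy
    rw [hM, Submodule.span_mul_span] at this
    refine Submodule.span_mono ?_ this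
    rintro _ ⟨_, ⟨g, F, rfl⟩, _, ⟨h, H, rfl⟩, rfl⟩
    exact ⟨_, _, (regRep_slice_mul hY g h F H).symm⟩
  | smul r x _ hx => exact M.smul_mem r hx
  | star x hx₀ hx =>
    clear hx₀
    induction hx using Submodule.span_induction with
    | mem x hx =>
      obtain ⟨g, F, rfl⟩ := hx
      rw [star_regRep_slice]
      exact Submodule.subset_span ⟨_, _, rfl⟩
    | zero => rw [star_zero]; exact M.zero_mem
    | add x y _ _ hx hy => rw [star_add]; exact M.add_mem hx hy
    | smul c x _ hx => rw [star_smul]; exact M.smul_mem _ hx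

theorem dense_span_sliceElt (hY : IsClopen Y) :
    Dense (Submodule.span ℂ {a | ∃ (g : G) (F : C_c(X, ℂ)), sliceElt hY g F = a} :
      Set (ReducedCStar G Y)) := by
  intro a
  rw [Topology.IsInducing.subtypeVal.closure_eq_preimage_closure_image]
  refine closure_mono (fun x hx => ?_) a.2
  have h : x ∈ (Submodule.span ℂ
      {a | ∃ (g : G) (F : C_c(X, ℂ)), sliceElt hY g F = a}).map
      (ReducedCStar G Y).toNonUnitalSubalgebra.toSubmodule.subtype := by
    rw [Submodule.map_span]
    refine Submodule.span_mono ?_ (adjoin_le_span_slice hY hx)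
    rintro _ ⟨g, F, rfl⟩
    exact ⟨_, ⟨g, F, rfl⟩, rfl⟩
  exact h

theorem condExpect_sliceElt_one (hY : IsClopen Y) (F : C_c(X, ℂ)) (x : Y) :
    condExpect (sliceElt hY (1 : G) F) x = F x := by
  rw [sliceElt_eq, condExpect_ofFun, slice_apply]
  exact if_pos rfl

theorem condExpect_sliceElt_of_ne (hY : IsClopen Y) {g : G} (hg : g ≠ 1) (F : C_c(X, ℂ)) (x : Y) :
    condExpect (sliceElt hY g F) x = 0 := by
  rw [sliceElt_eq, condExpect_ofFun, slice_apply]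
  exact if_neg hg.symm

theorem dynamics_sliceElt (hY : IsClopen Y) (N : G →* {r : ℝ // 0 < r}) (t : ℝ) (g : G)
    (F : C_c(X, ℂ)) :
    dynamics Y N t (sliceElt hY g F)
      = sliceElt hY g ((((N g : ℝ) : ℂ) ^ (Complex.I * t)) • F) := by
  rw [sliceElt_eq, sliceElt_eq, dynamics_ofFun]
  congr 1
  ext p
  change phase N t p * slice hY g F p = _
  rw [slice_apply, slice_apply, phase]
  split_ifs with h
  · rw [h]
    rfl
  · simp

theorem norm_sliceElt_one_le (hY : IsClopen Y) (F : C_c(X, ℂ)) {C : ℝ} (hC : ∀ x, ‖F x‖ ≤ C)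
    (hC0 : 0 ≤ C) : ‖sliceElt hY (1 : G) F‖ ≤ C := by
  change ‖regRep (slice hY (1 : G) F)‖ ≤ C
  refine ContinuousLinearMap.opNorm_le_bound _ hC0 fun ξ => ?_
  rw [← Real.norm_of_nonneg hC0, ← Complex.norm_real, ← norm_smul]
  refine lp.norm_mono (by norm_num) fun a => ?_
  rw [regRep_slice_apply]
  have : extendZero ξ (1⁻¹ * a.1.1) a.1.2 = ξ a := by
    simp only [inv_one, one_mul]
    exact dif_pos a.2
  rw [this, lp.coeFn_smul, Pi.smul_apply, norm_smul, norm_mul, Complex.norm_real,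
    Real.norm_of_nonneg hC0]
  exact mul_le_mul_of_nonneg_right (hC _) (norm_nonneg _)

end Slice

/-! ### The KMS condition for eigenvectors of the dynamics -/

section KMSEigen

open scoped ComplexOrder
open Complex MeasureTheory

variable {A : Type*} [NonUnitalCStarAlgebra A]

/-- A ⋆-homomorphism of C⋆-algebras as a continuous linear map. -/
noncomputable def starHomCLM (θ : A →⋆ₙₐ[ℂ] A) : A →L[ℂ] A :=
  LinearMap.mkContinuous { toFun := θ, map_add' := map_add θ, map_smul' := map_smul θ } 1
    fun a => by simpa using NonUnitalStarAlgHom.norm_apply_le θ a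

theorem starHomCLM_apply (θ : A →⋆ₙₐ[ℂ] A) (a : A) : starHomCLM θ a = θ a := rfl

/-- Entire functions that agree on the real line are equal. -/
theorem Differentiable.eq_of_eq_ofReal {F₁ F₂ : ℂ → A} (h₁ : Differentiable ℂ F₁)
    (h₂ : Differentiable ℂ F₂) (h : ∀ t : ℝ, F₁ t = F₂ t) : F₁ = F₂ := by
  have a₁ : AnalyticOnNhd ℂ F₁ Set.univ := fun z _ => h₁.analyticAt z
  have a₂ : AnalyticOnNhd ℂ F₂ Set.univ := fun z _ => h₂.analyticAt z
  refine a₁.eq_of_frequently_eq (z₀ := 0) a₂ ?_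
  have ht : Filter.Tendsto (fun n : ℕ => ((1 / ((n : ℝ) + 1) : ℝ) : ℂ)) Filter.atTop
      (nhdsWithin 0 {0}ᶜ) := by
    refine tendsto_nhdsWithin_iff.2 ⟨?_, Filter.Eventually.of_forall fun n => ?_⟩
    · have := (continuous_ofReal.tendsto 0).comp tendsto_one_div_add_atTop_nhds_zero_nat
      rwa [ofReal_zero] at this
    · have : (1 / ((n : ℝ) + 1)) ≠ 0 := by positivity
      rw [Set.mem_compl_singleton_iff]
      exact_mod_cast this
  exact ht.frequently (Filter.Frequently.of_forall fun n => h _)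

theorem IsEntireOrbit.shift {σ : ℝ → A →⋆ₙₐ[ℂ] A}
    (hadd : ∀ s t a, σ (s + t) a = σ s (σ t a)) {a : A} {F : ℂ → A}
    (hF : IsEntireOrbit (fun t a => σ t a) a F) (t : ℝ) (z : ℂ) : F (t + z) = σ t (F z) := by
  have := Differentiable.eq_of_eq_ofReal (F₁ := fun z => F (t + z))
    (F₂ := fun z => starHomCLM (σ t) (F z))
    (hF.1.comp ((differentiable_const _).add differentiable_id))
    ((starHomCLM (σ t)).differentiable.comp hF.1) (fun s => by
      simp only [starHomCLM_apply, hF.2, ← ofReal_add, hadd])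
  exact congrFun this z

/-- If `g` is entire, bounded on the vertical sides of the rectangles `[0, T] × [0, β]` by `M` and
within `ε₀` of `c₀` on the lower and within `ε₁` of `c₁` on the upper horizontal sides, then Cauchy's
theorem bounds `T ‖c₀ - c₁‖`. -/
theorem norm_sub_le_of_rect {g : ℂ → ℂ} (hg : Differentiable ℂ g) {β T M ε₀ ε₁ : ℝ} (hT : 0 ≤ T)
    {c₀ c₁ : ℂ} (h₀ : ∀ t : ℝ, ‖g t - c₀‖ ≤ ε₀) (h₁ : ∀ t : ℝ, ‖g (t + β * I) - c₁‖ ≤ ε₁)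
    (hM : ∀ t y : ℝ, y ∈ Set.uIcc 0 β → ‖g (t + y * I)‖ ≤ M) :
    T * ‖c₀ - c₁‖ ≤ T * (ε₀ + ε₁) + 2 * (M * |β|) := by
  have hrect := integral_boundary_rect_eq_zero_of_differentiableOn g 0 (T + β * I)
    hg.differentiableOn
  simp only [zero_re, zero_im, add_re, ofReal_re, mul_re, I_re, mul_zero, ofReal_im, I_im,
    mul_one, sub_self, add_zero, add_im, mul_im, zero_add, ofReal_zero, zero_mul] at hrect
  have hc := hg.continuous
  have i₀ : IntervalIntegrable (fun x : ℝ => g x) volume 0 T :=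
    (hc.comp continuous_ofReal).intervalIntegrable _ _
  have i₁ : IntervalIntegrable (fun x : ℝ => g (x + β * I)) volume 0 T :=
    (hc.comp (continuous_ofReal.add continuous_const)).intervalIntegrable _ _
  have e₀ : ‖(∫ x : ℝ in (0:ℝ)..T, g x) - T * c₀‖ ≤ ε₀ * |T - 0| := by
    have : (∫ x : ℝ in (0:ℝ)..T, g x) - T * c₀ = ∫ x : ℝ in (0:ℝ)..T, (g x - c₀) := by
      rw [intervalIntegral.integral_sub i₀ intervalIntegrable_const]
      simp
    rw [this]
    exact intervalIntegral.norm_integral_le_of_norm_le_const fun x _ => h₀ x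
  have e₁ : ‖(∫ x : ℝ in (0:ℝ)..T, g (x + β * I)) - T * c₁‖ ≤ ε₁ * |T - 0| := by
    have : (∫ x : ℝ in (0:ℝ)..T, g (x + β * I)) - T * c₁
        = ∫ x : ℝ in (0:ℝ)..T, (g (x + β * I) - c₁) := by
      rw [intervalIntegral.integral_sub i₁ intervalIntegrable_const]
      simp
    rw [this]
    exact intervalIntegral.norm_integral_le_of_norm_le_const fun x _ => h₁ x
  have e₂ : ‖∫ y : ℝ in (0:ℝ)..β, g (T + y * I)‖ ≤ M * |β - 0| :=
    intervalIntegral.norm_integral_le_of_norm_le_const fun y hy =>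
      hM T y (Set.uIoc_subset_uIcc hy)
  have e₃ : ‖∫ y : ℝ in (0:ℝ)..β, g (y * I)‖ ≤ M * |β - 0| :=
    intervalIntegral.norm_integral_le_of_norm_le_const fun y hy => by
      simpa using hM 0 y (Set.uIoc_subset_uIcc hy)
  rw [sub_zero, abs_of_nonneg hT] at e₀ e₁
  rw [sub_zero] at e₂ e₃
  set J₀ := ∫ x : ℝ in (0:ℝ)..T, g x
  set J₁ := ∫ x : ℝ in (0:ℝ)..T, g (x + β * I)
  set J₂ := ∫ y : ℝ in (0:ℝ)..β, g (T + y * I)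
  set J₃ := ∫ y : ℝ in (0:ℝ)..β, g (y * I)
  have key : (T : ℂ) * (c₀ - c₁)
      = -(J₀ - T * c₀) + (J₁ - T * c₁) + (I • J₃ - I • J₂) := by
    linear_combination hrect
  calc T * ‖c₀ - c₁‖ = ‖(T : ℂ) * (c₀ - c₁)‖ := by
        rw [norm_mul, norm_real, Real.norm_of_nonneg hT]
    _ ≤ ‖J₀ - T * c₀‖ + ‖J₁ - T * c₁‖ + (‖J₃‖ + ‖J₂‖) := by
        rw [key]
        refine (norm_add_le _ _).trans (add_le_add ((norm_add_le _ _).trans ?_)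
          ((norm_sub_le _ _).trans ?_))
        · rw [norm_neg]
        · simp
    _ ≤ _ := by linarith

/-- The KMS condition only mentions some set of analytic elements with dense span. It implies the
KMS relation for every eigenvector `a` of the dynamics and every `b`: for an analytic element `a'`
close to `a` in that span, the function `z ↦ r^{-iz} φ(b σ_z(a'))` is almost constant on the lines
`Im z = 0` and `Im z = β`, with values close to `φ(b a)` and `r^β φ(a b)`, and it is bounded on the
strip between them, so that by Cauchy's theorem the two values agree. -/
theorem IsKMSState.apply_mul_of_eigenvector {σ : ℝ → A →⋆ₙₐ[ℂ] A} (hzero : ∀ a, σ 0 a = a)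
    (hadd : ∀ s t a, σ (s + t) a = σ s (σ t a)) {β : ℝ} {φ : A →L[ℂ] ℂ}
    (hφ : IsKMSState (fun t a => σ t a) β φ) {r : ℝ} (hr : 0 < r) {a : A}
    (ha : ∀ t : ℝ, σ t a = (r : ℂ) ^ (I * t) • a) (b : A) :
    φ (a * b) = ((r ^ (-β) : ℝ) : ℂ) * φ (b * a) := by
  obtain ⟨⟨-, hnorm⟩, hinv, S, hS, hKMS⟩ := hφ
  have hr0 : (r : ℂ) ≠ 0 := by exact_mod_cast hr.ne'
  have hφle : ∀ x, ‖φ x‖ ≤ ‖x‖ := fun x => by simpa [hnorm] using φ.le_opNorm x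
  have hσle : ∀ t x, ‖σ t x‖ ≤ ‖x‖ := fun t x => NonUnitalStarAlgHom.norm_apply_le (σ t) x
  -- The KMS relation extends to `a'` in the span of `S` and to all `b`.
  have hspan : ∀ a' ∈ Submodule.span ℂ S, ∃ F : ℂ → A, IsEntireOrbit (fun t a => σ t a) a' F ∧
      ∀ b, φ (a' * b) = φ (b * F (I * β)) := by
    intro a' ha'
    induction ha' using Submodule.span_induction with
    | mem x hx =>
      obtain ⟨F, hF, h⟩ := hKMS x hx
      refine ⟨F, hF, fun b => ?_⟩
      have hlin : (φ.comp (ContinuousLinearMap.mul ℂ A x))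
          = φ.comp ((ContinuousLinearMap.mul ℂ A).flip (F (I * β))) := by
        refine ContinuousLinearMap.ext_on hS fun y hy => ?_
        exact h y hy
      exact congrArg (fun f : A →L[ℂ] ℂ => f b) hlin
    | zero => exact ⟨0, ⟨differentiable_const _, fun t => by simp⟩, fun b => by simp⟩
    | add x y _ _ hx hy =>
      obtain ⟨F₁, h₁, k₁⟩ := hx
      obtain ⟨F₂, h₂, k₂⟩ := hy
      refine ⟨F₁ + F₂, ⟨h₁.1.add h₂.1, fun t => ?_⟩, fun b => ?_⟩
      · simp [h₁.2, h₂.2]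
      · simp [add_mul, mul_add, k₁, k₂]
    | smul c x _ hx =>
      obtain ⟨F, h, k⟩ := hx
      refine ⟨c • F, ⟨h.1.const_smul c, fun t => ?_⟩, fun b => ?_⟩
      · simp [h.2]
      · rw [smul_mul_assoc, map_smul, k, Pi.smul_apply, mul_smul_comm, map_smul]
  suffices h : φ (b * a) = ((r ^ β : ℝ) : ℂ) * φ (a * b) by
    rw [h, ← mul_assoc, ← ofReal_mul, ← Real.rpow_add hr]
    simp
  -- The distance of the two sides is at most a multiple of `‖a' - a‖`.
  have hclose : ∀ a' ∈ Submodule.span ℂ S, ‖φ (b * a) - ((r ^ β : ℝ) : ℂ) * φ (a * b)‖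
      ≤ ‖a' - a‖ * (‖b‖ + r ^ β * ‖b‖) := by
    intro a' ha'
    obtain ⟨F, hF, hK⟩ := hspan a' ha'
    have hshift := hF.shift hadd
    obtain ⟨M, hM⟩ : ∃ M, ∀ y ∈ Set.uIcc 0 β, ‖r ^ y * (‖b‖ * ‖F (y * I)‖)‖ ≤ M := by
      refine isCompact_uIcc.exists_bound_of_continuousOn (Continuous.continuousOn ?_)
      have := hF.1.continuous
      exact (Real.continuous_const_rpow hr.ne').mul (by fun_prop)
    set g : ℂ → ℂ := fun z => (r : ℂ) ^ (-(I * z)) * φ (b * F z) with hgdef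
    have hg : Differentiable ℂ g := by
      refine Differentiable.mul (fun z => ?_) ?_
      · exact ((differentiable_id.const_mul I).neg z).const_cpow (Or.inl hr0)
      · exact (φ.comp (ContinuousLinearMap.mul ℂ A b)).differentiable.comp hF.1
    have hnr : ∀ t y : ℝ, ‖(r : ℂ) ^ (-(I * (t + y * I)))‖ = r ^ y := by
      intro t y
      rw [norm_cpow_eq_rpow_re_of_pos hr]
      simp
    have h₀ : ∀ t : ℝ, ‖g t - φ (b * a)‖ ≤ ‖a' - a‖ * ‖b‖ := by
      intro t
      have e : φ (b * a) = (r : ℂ) ^ (-(I * t)) * φ (b * σ t a) := by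
        rw [ha, mul_smul_comm, map_smul, smul_eq_mul, ← mul_assoc, ← cpow_add _ _ hr0]
        simp
      have hn := hnr t 0
      simp only [ofReal_zero, zero_mul, add_zero, Real.rpow_zero] at hn
      simp only [hgdef]
      rw [e, hF.2, ← mul_sub, ← map_sub, ← mul_sub, ← map_sub, norm_mul, hn, one_mul]
      calc _ ≤ ‖b * σ t (a' - a)‖ := hφle _
        _ ≤ ‖b‖ * ‖σ t (a' - a)‖ := norm_mul_le _ _
        _ ≤ ‖b‖ * ‖a' - a‖ := by gcongr; exact hσle _ _
        _ = _ := mul_comm _ _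
    have h₁ : ∀ t : ℝ, ‖g (t + β * I) - ((r ^ β : ℝ) : ℂ) * φ (a * b)‖
        ≤ ‖a' - a‖ * (r ^ β * ‖b‖) := by
      intro t
      have e1 : ∀ x, φ (σ t x * b) = φ (x * σ (-t) b) := by
        intro x
        rw [← hinv t (x * σ (-t) b)]
        simp only [map_mul]
        rw [← hadd, add_neg_cancel, hzero]
      have e2 : φ (b * F (t + β * I)) = φ (σ t a' * b) := by
        rw [hshift, e1, hK, ← hinv t (σ (-t) b * F (I * β))]
        simp only [map_mul]
        rw [← hadd, add_neg_cancel, hzero, mul_comm (β : ℂ) I]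
      have e3 : ((r ^ β : ℝ) : ℂ) * φ (a * b)
          = (r : ℂ) ^ (-(I * (t + β * I))) * φ (σ t a * b) := by
        rw [ha, smul_mul_assoc, map_smul, smul_eq_mul, ← mul_assoc, ← cpow_add _ _ hr0,
          ofReal_cpow hr.le]
        congr 2
        linear_combination (β : ℂ) * I_sq
      simp only [hgdef]
      rw [e3, e2, ← mul_sub, ← map_sub, ← sub_mul, ← map_sub, norm_mul, hnr]
      calc r ^ β * ‖φ (σ t (a' - a) * b)‖ ≤ r ^ β * ‖σ t (a' - a) * b‖ := by
            gcongr; exact hφle _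
        _ ≤ r ^ β * (‖σ t (a' - a)‖ * ‖b‖) := by gcongr; exact norm_mul_le _ _
        _ ≤ r ^ β * (‖a' - a‖ * ‖b‖) := by gcongr; exact hσle _ _
        _ = _ := by ring
    have h₂ : ∀ t y : ℝ, y ∈ Set.uIcc 0 β → ‖g (t + y * I)‖ ≤ M := by
      intro t y hy
      refine le_trans ?_ (hM y hy)
      simp only [hgdef]
      rw [norm_mul, hnr, hshift, Real.norm_of_nonneg (by positivity)]
      gcongr
      calc _ ≤ ‖b * σ t (F (y * I))‖ := hφle _
        _ ≤ ‖b‖ * ‖σ t (F (y * I))‖ := norm_mul_le _ _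
        _ ≤ _ := by gcongr; exact hσle _ _
    have hM0 : 0 ≤ M := (norm_nonneg _).trans (hM 0 Set.left_mem_uIcc)
    refine le_of_forall_pos_le_add fun ε hε => ?_
    have hT : 0 < (2 * (M * |β|) + 1) / ε := by positivity
    have h := norm_sub_le_of_rect hg hT.le h₀ h₁ h₂
    have hTε : (2 * (M * |β|) + 1) / ε * ε = 2 * (M * |β|) + 1 := div_mul_cancel₀ _ hε.ne'
    refine le_of_mul_le_mul_left ?_ hT
    rw [mul_add, hTε]
    linarith
  refine sub_eq_zero.1 (norm_le_zero_iff.1 (le_of_forall_pos_le_add fun ε hε => ?_))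
  have hC : 0 ≤ ‖b‖ + r ^ β * ‖b‖ := by positivity
  obtain ⟨a', ha', hd⟩ := Metric.dense_iff.1 hS a (ε / (‖b‖ + r ^ β * ‖b‖ + 1)) (by positivity)
  rw [zero_add]
  refine (hclose a' hd).trans ?_
  rw [Metric.mem_ball, dist_eq_norm] at ha'
  calc _ ≤ ε / (‖b‖ + r ^ β * ‖b‖ + 1) * (‖b‖ + r ^ β * ‖b‖ + 1) := by gcongr ?_ * ?_; linarith
    _ = ε := div_mul_cancel₀ _ (by positivity)

end KMSEigen

/-! ### Scaling measures are determined by their restriction to `Y` -/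

section ScalingMeasure

open MeasureTheory
open scoped Pointwise ENNReal

/-- The homomorphism `g ↦ N(g)^{-β}` into the extended nonnegative reals. -/
noncomputable def scaleHom {G : Type*} [Group G] (N : G →* {r : ℝ // 0 < r}) (β : ℝ) :
    G →* ℝ≥0∞ where
  toFun g := ENNReal.ofReal ((N g : ℝ) ^ (-β))
  map_one' := by simp
  map_mul' g h := by
    rw [map_mul, Positive.val_mul, Real.mul_rpow (N g).2.le (N h).2.le,
      ENNReal.ofReal_mul (by have := (N g).2; positivity)]

theorem scaleHom_apply {G : Type*} [Group G] (N : G →* {r : ℝ // 0 < r}) (β : ℝ) (g : G) :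
    scaleHom N β g = ENNReal.ofReal ((N g : ℝ) ^ (-β)) := rfl

theorem isLocallyFiniteMeasure_of_scaling {G X : Type*} [Group G] [MeasurableSpace X]
    [TopologicalSpace X] [MulAction G X] [ContinuousConstSMul G X] {Y : Set X}
    (hY : IsClopen Y) (hYm : MeasurableSet Y) (hGY : ⋃ g : G, g • Y = Set.univ)
    {c : G →* ℝ≥0∞} {μ : Measure X} (hfin : μ Y ≠ ∞)
    (hμ : ∀ (g : G) (Z : Set X), MeasurableSet Z → μ (g • Z) = c g * μ Z) :
    IsLocallyFiniteMeasure μ := by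
  refine ⟨fun x => ?_⟩
  obtain ⟨g, hg⟩ := Set.mem_iUnion.1 (hGY.symm ▸ Set.mem_univ x : x ∈ ⋃ g : G, g • Y)
  refine ⟨g • Y, (hY.isOpen.smul g).mem_nhds hg, ?_⟩
  rw [hμ g Y hYm]
  have hc : c g ≠ ∞ := by
    intro h
    have h1 : c g * c g⁻¹ = 1 := by rw [← map_mul]; simp
    rw [h] at h1
    by_cases h0 : c g⁻¹ = 0
    · simp [h0] at h1
    · rw [ENNReal.top_mul h0] at h1
      exact ENNReal.top_ne_one h1
  exact ENNReal.mul_lt_top hc.lt_top hfin.lt_top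

variable {G X : Type*} [Group G] [MeasurableSpace X] [MulAction G X]
  [MeasurableConstSMul G X] {Y : Set X}

theorem measure_smul_eq_tsum (m : Measure X) {D : ℕ → Set X} (hD : ∀ n, MeasurableSet (D n))
    (hdisj : Pairwise (Function.onFun Disjoint D)) (hunion : ⋃ n, D n = Set.univ) (h : G)
    {Z : Set X} (hZ : MeasurableSet Z) : m (h • Z) = ∑' n, m (h • (Z ∩ D n)) := by
  rw [← measure_iUnion]
  · rw [← Set.smul_set_iUnion, ← Set.inter_iUnion, hunion, Set.inter_univ]
  · intro i j hij
    exact Set.disjoint_smul_set.2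
      ((hdisj hij).mono Set.inter_subset_right Set.inter_subset_right)
  · exact fun n => (hZ.inter (hD n)).const_smul h

variable [Countable G]

theorem exists_partition_smul_subset (hY : MeasurableSet Y) (hGY : ⋃ g : G, g • Y = Set.univ) :
    ∃ (k : ℕ → G) (D : ℕ → Set X), (∀ n, MeasurableSet (D n)) ∧
      Pairwise (Function.onFun Disjoint D) ∧ ⋃ n, D n = Set.univ ∧ ∀ n, k n • D n ⊆ Y := by
  obtain ⟨e, he⟩ := exists_surjective_nat G
  refine ⟨fun n => (e n)⁻¹, disjointed fun n => e n • Y, fun n => ?_, disjoint_disjointed _, ?_,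
    fun n => ?_⟩
  · exact MeasurableSet.disjointed (fun n => hY.const_smul (e n)) n
  · rw [iUnion_disjointed, ← hGY]
    exact he.iUnion_comp fun g : G => g • Y
  · have := Set.smul_set_mono (a := (e n)⁻¹) (disjointed_subset (fun n => e n • Y) n)
    simpa using this

theorem measure_eq_of_scaling (hY : MeasurableSet Y) (hGY : ⋃ g : G, g • Y = Set.univ)
    {c : G →* ℝ≥0∞} {μ ν : Measure X}
    (hμ : ∀ (g : G) (Z : Set X), MeasurableSet Z → μ (g • Z) = c g * μ Z)
    (hν : ∀ (g : G) (Z : Set X), MeasurableSet Z → ν (g • Z) = c g * ν Z)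
    (h : ∀ Z ⊆ Y, MeasurableSet Z → μ Z = ν Z) : μ = ν := by
  obtain ⟨k, D, hD, hdisj, hunion, hk⟩ := exists_partition_smul_subset hY hGY
  ext Z hZ
  have key : ∀ m : Measure X, (∀ (g : G) (Z : Set X), MeasurableSet Z → m (g • Z) = c g * m Z) →
      m Z = ∑' n, c (k n)⁻¹ * m (k n • (Z ∩ D n)) := by
    intro m hm
    have := measure_smul_eq_tsum m hD hdisj hunion (1 : G) hZ
    simp only [one_smul] at this
    rw [this]
    refine tsum_congr fun n => ?_
    rw [hm _ _ (hZ.inter (hD n)), ← mul_assoc, ← map_mul]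
    simp
  rw [key μ hμ, key ν hν]
  refine tsum_congr fun n => ?_
  rw [h _ ((Set.smul_set_mono Set.inter_subset_right).trans (hk n))
    ((hZ.inter (hD n)).const_smul _)]

/-- A measure that scales correctly under the partial action of `G` on `Y` extends to a measure on
`X` that scales correctly under `G`. With `X` cut into pieces `D n` that some `k n ∈ G` moves into
`Y`, the extension has to be `Z ↦ ∑ₙ c(k n)⁻¹ μ₀(k n (Z ∩ D n))`. -/
theorem exists_scaling_extension (hY : MeasurableSet Y) (hGY : ⋃ g : G, g • Y = Set.univ)
    {c : G →* ℝ≥0∞} {μ₀ : Measure X}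
    (h₀ : ∀ (g : G) (Z : Set X), MeasurableSet Z → Z ⊆ Y → g • Z ⊆ Y → μ₀ (g • Z) = c g * μ₀ Z) :
    ∃ μ : Measure X, (∀ Z ⊆ Y, MeasurableSet Z → μ Z = μ₀ Z) ∧
      ∀ (g : G) (Z : Set X), MeasurableSet Z → μ (g • Z) = c g * μ Z := by
  obtain ⟨k, D, hD, hdisj, hunion, hk⟩ := exists_partition_smul_subset hY hGY
  let μ : Measure X := Measure.sum fun n =>
    c (k n)⁻¹ • (μ₀.map fun x => (k n)⁻¹ • x).restrict (D n)
  have hμ : ∀ Z, MeasurableSet Z → μ Z = ∑' n, c (k n)⁻¹ * μ₀ (k n • (Z ∩ D n)) := by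
    intro Z hZ
    rw [Measure.sum_apply _ hZ]
    refine tsum_congr fun n => ?_
    rw [Measure.smul_apply, Measure.restrict_apply hZ, Measure.map_apply
      (measurable_const_smul _) (hZ.inter (hD n)), Set.preimage_smul, inv_inv, smul_eq_mul]
  have hμk : ∀ (g : G) (Z : Set X), MeasurableSet Z → g • Z ⊆ Y →
      μ Z = c g⁻¹ * μ₀ (g • Z) := by
    intro g Z hZ hg
    rw [hμ Z hZ, measure_smul_eq_tsum μ₀ hD hdisj hunion g hZ, ← ENNReal.tsum_mul_left]
    refine tsum_congr fun n => ?_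
    have h1 := h₀ (g * (k n)⁻¹) (k n • (Z ∩ D n)) ((hZ.inter (hD n)).const_smul _)
      ((Set.smul_set_mono Set.inter_subset_right).trans (hk n)) (by
        rw [smul_smul, inv_mul_cancel_right]
        exact (Set.smul_set_mono Set.inter_subset_left).trans hg)
    rw [smul_smul, inv_mul_cancel_right] at h1
    rw [h1, ← mul_assoc, ← map_mul, inv_mul_cancel_left]
  refine ⟨μ, fun Z hZY hZ => ?_, fun g Z hZ => ?_⟩
  · simpa using hμk 1 Z hZ (by simpa using hZY)
  · have h1 := measure_smul_eq_tsum μ hD hdisj hunion (1 : G) hZ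
    simp only [one_smul] at h1
    rw [measure_smul_eq_tsum μ hD hdisj hunion g hZ, h1, ← ENNReal.tsum_mul_left]
    refine tsum_congr fun n => ?_
    have hsub : k n • (Z ∩ D n) ⊆ Y := (Set.smul_set_mono Set.inter_subset_right).trans (hk n)
    rw [hμk (k n) _ (hZ.inter (hD n)) hsub,
      hμk (k n * g⁻¹) _ ((hZ.inter (hD n)).const_smul g) (by
        rwa [smul_smul, inv_mul_cancel_right]),
      smul_smul, inv_mul_cancel_right, ← mul_assoc, ← map_mul, mul_inv_rev, inv_inv]

end ScalingMeasure

/-! ### An axiomatic description of the reduced C⋆-algebra -/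

open scoped CompactlySupported ComplexOrder in
/-- The properties of `C⋆_r(G ⊠ Y)`, its dynamics and its conditional expectation on which the
classification of KMS states rests: it is a C⋆-algebra `A` with elements `elt g F = u_g F`,
`F ∈ C_c(X)`, that multiply as in the groupoid algebra and span a dense subspace. -/
structure SliceSystem {G X : Type*} [Group G] [TopologicalSpace X] [T2Space X] [MulAction G X]
    [ContinuousConstSMul G X] {Y : Set X} (hY : IsClopen Y) (N : G →* {r : ℝ // 0 < r})
    (A : Type*) [NonUnitalCStarAlgebra A] where
  /-- The element `u_g F`. -/
  elt : G → C_c(X, ℂ) →ₗ[ℂ] A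
  /-- The dynamics. -/
  dyn : ℝ → A →⋆ₙₐ[ℂ] A
  /-- The conditional expectation. -/
  expect : A →ₗ[ℂ] (Y → ℂ)
  elt_congr : ∀ (g : G) {F₁ F₂ : C_c(X, ℂ)}, (∀ x ∈ Y, g • x ∈ Y → F₁ x = F₂ x) →
    elt g F₁ = elt g F₂
  elt_mul : ∀ (g h : G) (F H : C_c(X, ℂ)), elt g F * elt h H = elt (g * h) (sliceMul hY F h H)
  star_elt : ∀ (g : G) (F : C_c(X, ℂ)), star (elt g F) = elt g⁻¹ (sliceStar hY g F)
  dense_span : Dense (Submodule.span ℂ {a | ∃ (g : G) (F : C_c(X, ℂ)), elt g F = a} : Set A)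
  norm_elt_one_le : ∀ {F : C_c(X, ℂ)}, (∀ x, ‖F x‖ ≤ 1) → ‖elt 1 F‖ ≤ 1
  dyn_zero : ∀ a, dyn 0 a = a
  dyn_add : ∀ s t a, dyn (s + t) a = dyn s (dyn t a)
  dyn_elt : ∀ (t : ℝ) (g : G) (F : C_c(X, ℂ)),
    dyn t (elt g F) = ((N g : ℝ) : ℂ) ^ (Complex.I * t) • elt g F
  expect_elt_one : ∀ (F : C_c(X, ℂ)) (x : Y), expect (elt 1 F) x = F x
  expect_elt_of_ne : ∀ {g : G}, g ≠ 1 → ∀ (F : C_c(X, ℂ)) (x : Y), expect (elt g F) x = 0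
  norm_expect_le : ∀ a x, ‖expect a x‖ ≤ ‖a‖
  expect_star_mul_self : ∀ a x, 0 ≤ expect (star a * a) x

section Concrete

open RestrictedGroupoid
open scoped ComplexOrder

variable {G X : Type*} [Group G] [MulAction G X] {Y : Set X}

theorem phaseUnitary_add (N : G →* {r : ℝ // 0 < r}) (s t : ℝ) :
    phaseUnitary Y N (s + t) = phaseUnitary Y N s * phaseUnitary Y N t := by
  apply Subtype.ext
  ext ξ a
  change phase N (s + t) a * ξ a = phase N s a * (phase N t a * ξ a)
  rw [← mul_assoc, phase, phase, phase, ← Complex.cpow_add _ _ (by exact_mod_cast (N a.1.1).2.ne')]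
  push_cast
  rw [mul_add]

theorem phaseUnitary_zero (N : G →* {r : ℝ // 0 < r}) : phaseUnitary Y N 0 = 1 := by
  apply Subtype.ext
  ext ξ a
  change phase N 0 a * ξ a = ξ a
  simp [phase]

variable [TopologicalSpace G] [DiscreteTopology G] [TopologicalSpace X]

theorem dynamics_zero_apply (N : G →* {r : ℝ // 0 < r}) (a : ReducedCStar G Y) :
    dynamics Y N 0 a = a := by
  apply Subtype.ext
  change conjBy (phaseUnitary Y N 0) a.1 = a.1
  rw [conjBy_apply, phaseUnitary_zero]
  simp

theorem dynamics_add_apply (N : G →* {r : ℝ // 0 < r}) (s t : ℝ) (a : ReducedCStar G Y) :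
    dynamics Y N (s + t) a = dynamics Y N s (dynamics Y N t a) := by
  apply Subtype.ext
  change conjBy (phaseUnitary Y N (s + t)) a.1
    = conjBy (phaseUnitary Y N s) (conjBy (phaseUnitary Y N t) a.1)
  simp only [conjBy_apply, phaseUnitary_add, Submonoid.coe_mul, star_mul, mul_assoc]

theorem condExpect_star_mul_self_nonneg (a : ReducedCStar G Y) (x : Y) :
    0 ≤ condExpect (star a * a) x := by
  classical
  set δ : EllTwo (RestrictedGroupoid G Y) := lp.single 2 (unitAt G x) (1 : ℂ) with hδ
  have h1 := lp.inner_single_left (𝕜 := ℂ) (unitAt G x : RestrictedGroupoid G Y) (1 : ℂ)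
    (star a.1 (a.1 δ))
  rw [ContinuousLinearMap.star_eq_adjoint, ContinuousLinearMap.adjoint_inner_right] at h1
  have h2 : condExpect (star a * a) x = inner ℂ (a.1 δ) (a.1 δ) := by
    simp only [RCLike.inner_apply, map_one, mul_one] at h1
    rw [hδ, h1]
    rfl
  rw [h2, inner_self_eq_norm_sq_to_K]
  have h := Complex.zero_le_real.2 (sq_nonneg ‖a.1 δ‖)
  rw [Complex.ofReal_pow] at h
  exact h

/-- The conditional expectation as a linear map. -/
noncomputable def condExpectₗ : ReducedCStar G Y →ₗ[ℂ] (Y → ℂ) where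
  toFun := condExpect
  map_add' _ _ := rfl
  map_smul' _ _ := rfl

variable [T2Space X] [ContinuousConstSMul G X]

/-- The reduced C⋆-algebra of `G ⊠ Y` as a `SliceSystem`. -/
noncomputable def reducedSliceSystem (hY : IsClopen Y) (N : G →* {r : ℝ // 0 < r}) :
    SliceSystem hY N (ReducedCStar G Y) where
  elt := sliceElt hY
  dyn := dynamics Y N
  expect := condExpectₗ
  elt_congr := sliceElt_congr hY
  elt_mul := sliceElt_mul hY
  star_elt := star_sliceElt hY
  dense_span := dense_span_sliceElt hY
  norm_elt_one_le h := norm_sliceElt_one_le hY _ h zero_le_one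
  dyn_zero := dynamics_zero_apply N
  dyn_add := dynamics_add_apply N
  dyn_elt t g F := (dynamics_sliceElt hY N t g F).trans (LinearMap.map_smul (sliceElt hY g) _ F)
  expect_elt_one := condExpect_sliceElt_one hY
  expect_elt_of_ne := condExpect_sliceElt_of_ne hY
  norm_expect_le := norm_condExpect_le
  expect_star_mul_self := condExpect_star_mul_self_nonneg

end Concrete

end ReducedAlgebra

section Classification

open MeasureTheory
open scoped CompactlySupported ComplexOrder Pointwise ENNReal

/-! ### From scaling measures to KMS states -/

/-- A real valued function in `C_c(X)` as a complex valued one. -/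
noncomputable def complexify {X : Type*} [TopologicalSpace X] : C_c(X, ℝ) →ₗ[ℝ] C_c(X, ℂ) where
  toFun f := ⟨⟨fun x => (f x : ℂ), Complex.continuous_ofReal.comp f.continuous⟩,
    HasCompactSupport.comp_left (g := fun r : ℝ => (r : ℂ)) f.hasCompactSupport (by simp)⟩
  map_add' f₁ f₂ := by
    ext x
    exact Complex.ofReal_add (f₁ x) (f₂ x)
  map_smul' c f := by
    ext x
    exact Complex.ofReal_mul c (f x)

theorem complexify_apply {X : Type*} [TopologicalSpace X] (f : C_c(X, ℝ)) (x : X) :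
    complexify f x = (f x : ℂ) := rfl

theorem comap_subtype_val_univ {X : Type*} [MeasurableSpace X] (μ : Measure X)
    {Y : Set X} (hY : MeasurableSet Y) : μ.comap ((↑) : Y → X) Set.univ = μ Y := by
  rw [Measure.comap_apply _ Subtype.val_injective (fun s hs => hY.subtype_image hs) _
    MeasurableSet.univ, Set.image_univ, Subtype.range_coe]

theorem integral_inv_smul_of_scaling {G X : Type*} [Group G] [MulAction G X]
    [MeasurableSpace X] [MeasurableConstSMul G X] {N : G →* {r : ℝ // 0 < r}} {μ : Measure X} {β : ℝ}
    (hμ : ∀ (g : G) (Z : Set X), MeasurableSet Z → μ (g • Z) = scaleHom N β g * μ Z)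
    (g : G) (Ψ : X → ℂ) :
    ∫ x, Ψ (g⁻¹ • x) ∂μ = (((N g : ℝ) ^ (-β) : ℝ) : ℂ) * ∫ x, Ψ x ∂μ := by
  have hmap : μ.map (fun x => g⁻¹ • x) = scaleHom N β g • μ := by
    ext Z hZ
    rw [Measure.map_apply (measurable_const_smul _) hZ, Set.preimage_smul, inv_inv, hμ g Z hZ]
    rfl
  rw [← (measurableEmbedding_const_smul g⁻¹).integral_map (g := Ψ), hmap, integral_smul_measure,
    scaleHom_apply, ENNReal.toReal_ofReal (by have := (N g).2; positivity), Complex.real_smul]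

namespace SliceSystem

variable {G X : Type*} [Group G] [TopologicalSpace X] [T2Space X] [MulAction G X]
    [ContinuousConstSMul G X] {Y : Set X} {hY : IsClopen Y} {N : G →* {r : ℝ // 0 < r}}
    {A : Type*} [NonUnitalCStarAlgebra A] (S : SliceSystem hY N A)

/-- Continuous linear maps that agree on the elements `u_g F` are equal. -/
theorem clm_ext {φ ψ : A →L[ℂ] ℂ} (h : ∀ g F, φ (S.elt g F) = ψ (S.elt g F)) : φ = ψ := by
  refine ContinuousLinearMap.ext_on S.dense_span ?_
  rintro _ ⟨g, F, rfl⟩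
  exact h g F

theorem elt_one_mul_elt (F H : C_c(X, ℂ)) (g : G) : S.elt g F * S.elt 1 H = S.elt g (F * H) := by
  rw [S.elt_mul, mul_one]
  refine S.elt_congr g fun x hx _ => ?_
  rw [sliceMul_apply, one_smul, Set.indicator_of_mem hx]
  rfl

theorem star_elt_one (F : C_c(X, ℂ)) : star (S.elt 1 F) = S.elt 1 (star F) := by
  rw [S.star_elt, inv_one]
  refine S.elt_congr 1 fun x hx _ => ?_
  rw [sliceStar_apply, inv_one, one_smul, Set.indicator_of_mem hx]
  rfl

variable [MeasurableSpace X] [BorelSpace X]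

theorem measurable_expect (a : A) : Measurable (S.expect a) := by
  have hspan : ∀ a ∈ Submodule.span ℂ {a | ∃ (g : G) (F : C_c(X, ℂ)), S.elt g F = a},
      Measurable (S.expect a) := by
    intro a ha
    induction ha using Submodule.span_induction with
    | mem x hx =>
      obtain ⟨g, F, rfl⟩ := hx
      by_cases hg : g = 1
      · subst hg
        rw [funext (S.expect_elt_one F)]
        exact F.continuous.measurable.comp measurable_subtype_coe
      · rw [funext (S.expect_elt_of_ne hg F)]
        exact measurable_const
    | zero => rw [map_zero]; exact measurable_const
    | add x y _ _ hx hy => rw [map_add]; exact hx.add hy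
    | smul c x _ hx => rw [map_smul]; exact hx.const_smul c
  obtain ⟨u, hu, hlim⟩ := mem_closure_iff_seq_limit.1 (S.dense_span a)
  refine measurable_of_tendsto_metrizable (fun n => hspan (u n) (hu n)) ?_
  rw [tendsto_pi_nhds]
  intro x
  rw [tendsto_iff_norm_sub_tendsto_zero] at hlim ⊢
  refine squeeze_zero (fun _ => norm_nonneg _) (fun n => ?_) hlim
  rw [← Pi.sub_apply, ← map_sub]
  exact S.norm_expect_le _ _

theorem integrable_expect (ν : Measure Y) [IsFiniteMeasure ν] (a : A) :
    Integrable (S.expect a) ν :=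
  Integrable.of_bound (S.measurable_expect a).aestronglyMeasurable ‖a‖
    (Filter.Eventually.of_forall (S.norm_expect_le a))

/-- The functional `a ↦ ∫ E(a) dν` given by a finite measure `ν` on `Y`. -/
noncomputable def integralFunctional (ν : Measure Y) [IsFiniteMeasure ν] : A →L[ℂ] ℂ :=
  LinearMap.mkContinuous
    { toFun := fun a => ∫ x, S.expect a x ∂ν
      map_add' := fun a b => by
        rw [map_add]
        exact integral_add (S.integrable_expect ν a) (S.integrable_expect ν b)
      map_smul' := fun c a => by
        rw [map_smul]
        exact integral_smul c _ } (ν.real Set.univ) fun a => by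
    have := norm_integral_le_of_norm_le_const (μ := ν)
      (Filter.Eventually.of_forall (S.norm_expect_le a))
    rwa [mul_comm]

theorem integralFunctional_apply (ν : Measure Y) [IsFiniteMeasure ν] (a : A) :
    S.integralFunctional ν a = ∫ x, S.expect a x ∂ν := rfl

theorem norm_integralFunctional_le (ν : Measure Y) [IsFiniteMeasure ν] :
    ‖S.integralFunctional ν‖ ≤ ν.real Set.univ :=
  LinearMap.mkContinuous_norm_le _ measureReal_nonneg _

theorem integralFunctional_elt_one (μ : Measure X) [IsFiniteMeasure (μ.comap ((↑) : Y → X))]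
    (F : C_c(X, ℂ)) :
    S.integralFunctional (μ.comap ((↑) : Y → X)) (S.elt 1 F) = ∫ x in Y, F x ∂μ := by
  rw [integralFunctional_apply, ← integral_subtype_comap hY.isOpen.measurableSet]
  simp only [S.expect_elt_one]

theorem integralFunctional_elt_of_ne (ν : Measure Y) [IsFiniteMeasure ν]
    {g : G} (hg : g ≠ 1) (F : C_c(X, ℂ)) : S.integralFunctional ν (S.elt g F) = 0 := by
  rw [integralFunctional_apply]
  simp only [S.expect_elt_of_ne hg, integral_zero]

theorem one_le_norm_integralFunctional {μ : Measure X} [LocallyCompactSpace X] [μ.Regular]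
    (hμY : μ Y = 1) [IsProbabilityMeasure (μ.comap ((↑) : Y → X))] :
    1 ≤ ‖S.integralFunctional (μ.comap ((↑) : Y → X))‖ := by
  refine le_of_forall_lt fun c hc => ?_
  by_cases hc0 : c < 0
  · exact hc0.trans_le (norm_nonneg _)
  push Not at hc0
  obtain ⟨K, hKY, hK, hcK⟩ := hY.isOpen.exists_lt_isCompact (μ := μ) (r := ENNReal.ofReal c)
    (by rw [hμY]; exact ENNReal.ofReal_lt_one.2 hc)
  obtain ⟨f, hf1, hfc, -, hf01⟩ :=
    exists_continuousMap_one_of_isCompact_subset_isOpen hK isOpen_univ (Set.subset_univ K)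
  set F : C_c(X, ℂ) := complexify ⟨f, hfc⟩
  have hFn : ‖S.elt 1 F‖ ≤ 1 := S.norm_elt_one_le fun x => by
    change ‖((f x : ℝ) : ℂ)‖ ≤ 1
    rw [Complex.norm_real, Real.norm_of_nonneg (hf01 x).1]
    exact (hf01 x).2
  have hFi : S.integralFunctional (μ.comap ((↑) : Y → X)) (S.elt 1 F)
      = ((∫ x in Y, f x ∂μ : ℝ) : ℂ) := by
    rw [integralFunctional_elt_one]
    exact integral_ofReal
  have hfin : μ Y ≠ ∞ := by simp [hμY]
  have hint : IntegrableOn f Y μ := by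
    refine Integrable.mono' (g := fun _ => (1 : ℝ)) (integrableOn_const hfin)
      f.continuous.aestronglyMeasurable (Filter.Eventually.of_forall fun x => ?_)
    rw [Real.norm_of_nonneg (hf01 x).1]
    exact (hf01 x).2
  have h1 : c < (μ K).toReal := by
    rw [← ENNReal.ofReal_lt_iff_lt_toReal hc0 (ne_top_of_le_ne_top hfin (measure_mono hKY))]
    exact hcK
  have h2 : (μ K).toReal ≤ ∫ x in Y, f x ∂μ := by
    calc (μ K).toReal = ∫ x in K, f x ∂μ := by
          rw [setIntegral_congr_fun hK.measurableSet hf1]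
          simp [Measure.real]
      _ ≤ ∫ x in Y, f x ∂μ := setIntegral_mono_set hint
          (Filter.Eventually.of_forall fun x => (hf01 x).1) hKY.eventuallyLE
  calc c < ∫ x in Y, f x ∂μ := h1.trans_le h2
    _ ≤ ‖S.integralFunctional (μ.comap ((↑) : Y → X)) (S.elt 1 F)‖ := by
        rw [hFi, Complex.norm_real]
        exact Real.le_norm_self _
    _ ≤ ‖S.integralFunctional (μ.comap ((↑) : Y → X))‖ * ‖S.elt 1 F‖ :=
        ContinuousLinearMap.le_opNorm _ _
    _ ≤ _ := mul_le_of_le_one_right (norm_nonneg _) hFn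

/-- For a scaling measure `μ`, the state `μ ∘ E` satisfies the KMS relation for the elements
`u_g F`: the relation for `u_g F` and `u_{g⁻¹} H` is the change of variables `y = g x`. -/
theorem isKMSState_integralFunctional [LocallyCompactSpace X] {β : ℝ} {μ : Measure X}
    [μ.Regular] (hμY : μ Y = 1)
    (hμ : ∀ (g : G) (Z : Set X), MeasurableSet Z → μ (g • Z) = scaleHom N β g * μ Z)
    [IsProbabilityMeasure (μ.comap ((↑) : Y → X))] :
    IsKMSState (fun t a => S.dyn t a) β (S.integralFunctional (μ.comap ((↑) : Y → X))) := by
  set φ := S.integralFunctional (μ.comap ((↑) : Y → X)) with hφ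
  have hNpos : ∀ g, ((N g : ℝ) : ℂ) ≠ 0 := fun g => by exact_mod_cast (N g).2.ne'
  refine ⟨⟨fun a => ?_, le_antisymm ?_ (S.one_le_norm_integralFunctional hμY)⟩, fun t a => ?_,
    {a | ∃ (g : G) (F : C_c(X, ℂ)), S.elt g F = a}, S.dense_span, ?_⟩
  · rw [hφ, integralFunctional_apply]
    exact integral_nonneg (S.expect_star_mul_self a)
  · exact (S.norm_integralFunctional_le _).trans (by simp)
  · have : φ.comp (starHomCLM (S.dyn t)) = φ := by
      refine S.clm_ext fun g F => ?_
      rw [ContinuousLinearMap.comp_apply, starHomCLM_apply, S.dyn_elt, map_smul]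
      by_cases hg : g = 1
      · simp [hg]
      · rw [hφ, S.integralFunctional_elt_of_ne _ hg, smul_zero]
    exact congrArg (fun f : A →L[ℂ] ℂ => f a) this
  · rintro _ ⟨g, F, rfl⟩
    refine ⟨fun z => ((N g : ℝ) : ℂ) ^ (Complex.I * z) • S.elt g F, ⟨?_, fun t => ?_⟩, ?_⟩
    · refine Differentiable.smul_const (fun z => ?_) _
      exact ((differentiable_id.const_mul Complex.I) z).const_cpow (Or.inl (hNpos g))
    · exact (S.dyn_elt t g F).symm
    · rintro _ ⟨h, H, rfl⟩
      rw [mul_smul_comm, map_smul, S.elt_mul, S.elt_mul]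
      by_cases hgh : g * h = 1
      · obtain rfl := eq_inv_of_mul_eq_one_right hgh
        rw [mul_inv_cancel, inv_mul_cancel, hφ, integralFunctional_elt_one,
          integralFunctional_elt_one]
        have e : ((N g : ℝ) : ℂ) ^ (Complex.I * (Complex.I * β)) = (((N g : ℝ) ^ (-β) : ℝ) : ℂ) := by
          rw [Complex.ofReal_cpow (N g).2.le, ← mul_assoc, Complex.I_mul_I]
          simp
        rw [e, smul_eq_mul, ← integral_indicator hY.isOpen.measurableSet,
          ← integral_indicator hY.isOpen.measurableSet, ← integral_inv_smul_of_scaling hμ]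
        refine integral_congr_ae (Filter.Eventually.of_forall fun y => ?_)
        classical
        simp only [Set.indicator_apply, sliceMul_apply, smul_inv_smul]
        split_ifs <;> ring
      · rw [hφ, S.integralFunctional_elt_of_ne _ hgh, S.integralFunctional_elt_of_ne, smul_zero]
        exact fun h' => hgh (mul_eq_one_comm.1 h')

/-- A scaling measure is determined by its KMS state. -/
theorem eq_of_integralFunctional_eq [Countable G] [SecondCountableTopology X]
    [LocallyCompactSpace X] (hGY : ⋃ g : G, g • Y = Set.univ) {β : ℝ} {μ ν : Measure X}
    (hμY : μ Y = 1) (hνY : ν Y = 1)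
    (hμ : ∀ (g : G) (Z : Set X), MeasurableSet Z → μ (g • Z) = scaleHom N β g * μ Z)
    (hν : ∀ (g : G) (Z : Set X), MeasurableSet Z → ν (g • Z) = scaleHom N β g * ν Z)
    [IsProbabilityMeasure (μ.comap ((↑) : Y → X))] [IsProbabilityMeasure (ν.comap ((↑) : Y → X))]
    (h : S.integralFunctional (μ.comap ((↑) : Y → X))
      = S.integralFunctional (ν.comap ((↑) : Y → X))) : μ = ν := by
  refine measure_eq_of_scaling hY.isOpen.measurableSet hGY hμ hν ?_
  have : IsFiniteMeasure (μ.restrict Y) := ⟨by simp [hμY]⟩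
  have : IsFiniteMeasure (ν.restrict Y) := ⟨by simp [hνY]⟩
  have hres : μ.restrict Y = ν.restrict Y := by
    refine Measure.ext_of_integral_eq_on_compactlySupported fun f => ?_
    have hF := congrArg (fun φ : A →L[ℂ] ℂ => φ (S.elt 1 (complexify f))) h
    simp only [integralFunctional_elt_one, complexify_apply, integral_complex_ofReal] at hF
    exact_mod_cast hF
  intro Z hZY hZ
  have := congrArg (fun m : Measure X => m Z) hres
  simp only [Measure.restrict_apply hZ, Set.inter_eq_self_of_subset_left hZY] at this
  exact this

end SliceSystem

/-! ### From KMS states to scaling measures -/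

/-- The Cauchy–Schwarz inequality for a positive functional on a C⋆-algebra. -/
theorem norm_sq_apply_star_mul_le {A : Type*} [NonUnitalCStarAlgebra A] {φ : A →L[ℂ] ℂ}
    (hφ : ∀ a, 0 ≤ φ (star a * a)) (a b : A) :
    ‖φ (star a * b)‖ ^ 2 ≤ (φ (star a * a)).re * (φ (star b * b)).re := by
  have hexp : ∀ z : ℂ, φ (star (a + z • b) * (a + z • b)) = φ (star a * a) + z * φ (star a * b)
      + star z * φ (star b * a) + star z * z * φ (star b * b) := by
    intro z
    simp only [star_add, star_smul, add_mul, mul_add, smul_mul_assoc, mul_smul_comm, map_add,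
      map_smul, smul_eq_mul]
    ring
  have hre : ∀ a, 0 ≤ (φ (star a * a)).re := fun a => (Complex.nonneg_iff.1 (hφ a)).1
  have him : ∀ a, (φ (star a * a)).im = 0 := fun a => (Complex.nonneg_iff.1 (hφ a)).2.symm
  -- Positivity at `a + b` and `a + i b` shows that the form is Hermitian.
  have hconj : φ (star b * a) = star (φ (star a * b)) := by
    have h1 := him (a + (1 : ℂ) • b)
    have h2 := him (a + Complex.I • b)
    rw [hexp] at h1 h2
    simp [him] at h1 h2
    apply Complex.ext <;> simp <;> linarith
  have key : ∀ t : ℝ, 0 ≤ (φ (star b * b)).re * ‖φ (star a * b)‖ ^ 2 * (t * t)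
      + (-(2 * ‖φ (star a * b)‖ ^ 2)) * t + (φ (star a * a)).re := by
    intro t
    have h := hre (a + (-(t : ℂ) * star (φ (star a * b))) • b)
    rw [hexp, hconj] at h
    set u := φ (star a * b)
    have hu : ‖u‖ ^ 2 = u.re * u.re + u.im * u.im := by
      rw [← Complex.normSq_eq_norm_sq, Complex.normSq_apply]
    rw [hu]
    simp [him] at h
    linarith
  have hd := discrim_le_zero key
  rw [discrim] at hd
  set n := ‖φ (star a * b)‖ ^ 2
  have hn : 0 ≤ n := sq_nonneg _
  rcases hn.eq_or_lt with h0 | h0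
  · rw [← h0]
    exact mul_nonneg (hre a) (hre b)
  · nlinarith

namespace SliceSystem

variable {G X : Type*} [Group G] [TopologicalSpace X] [T2Space X] [MulAction G X]
    [ContinuousConstSMul G X] {Y : Set X} {hY : IsClopen Y} {N : G →* {r : ℝ // 0 < r}}
    {A : Type*} [NonUnitalCStarAlgebra A] (S : SliceSystem hY N A)

variable {φ : A →L[ℂ] ℂ}

theorem apply_elt_one_nonneg (hφ : ∀ a, 0 ≤ φ (star a * a)) {f : C_c(X, ℝ)} (hf : 0 ≤ f) :
    0 ≤ φ (S.elt 1 (complexify f)) := by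
  have e : S.elt 1 (complexify f)
      = star (S.elt 1 (complexify (f.compLeft ⟨Real.sqrt, Real.continuous_sqrt⟩)))
        * S.elt 1 (complexify (f.compLeft ⟨Real.sqrt, Real.continuous_sqrt⟩)) := by
    rw [star_elt_one, elt_one_mul_elt]
    congr 1
    ext x
    have h0 : (⟨Real.sqrt, Real.continuous_sqrt⟩ : C(ℝ, ℝ)) 0 = 0 := Real.sqrt_zero
    simp only [CompactlySupportedContinuousMap.mul_apply,
      CompactlySupportedContinuousMap.star_apply, complexify_apply,
      CompactlySupportedContinuousMap.compLeft_apply h0, ContinuousMap.coe_mk, Complex.star_def,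
      Complex.conj_ofReal]
    rw [← Complex.ofReal_mul, Real.mul_self_sqrt (hf x)]
  rw [e]
  exact hφ _

variable [LocallyCompactSpace X] [MeasurableSpace X] [BorelSpace X]

/-- The measure that represents the restriction of a state `φ` to `C_c(X)`. -/
theorem exists_measure_of_state (hφ : IsCStarState φ) :
    ∃ μ : Measure X, μ.Regular ∧ μ Set.univ ≤ 1 ∧ μ Yᶜ = 0 ∧
      ∀ F : C_c(X, ℂ), φ (S.elt 1 F) = ∫ x, F x ∂μ := by
  obtain ⟨hpos, hnorm⟩ := hφ
  let Λ : C_c(X, ℝ) →ₚ[ℝ] ℝ := PositiveLinearMap.mk₀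
    { toFun := fun f => (φ (S.elt 1 (complexify f))).re
      map_add' := fun f₁ f₂ => by simp
      map_smul' := fun c f => by
        have : complexify (c • f) = (c : ℂ) • complexify f := by
          ext x
          exact Complex.ofReal_mul c (f x)
        simp [this] } fun f hf => (Complex.nonneg_iff.1 (S.apply_elt_one_nonneg hpos hf)).1
  have hΛ : ∀ f, Λ f = (φ (S.elt 1 (complexify f))).re := fun f => rfl
  let μ := RealRMK.rieszMeasure Λ
  have hμreg : μ.Regular := inferInstance
  have hmass : μ Set.univ ≤ 1 := by
    rw [isOpen_univ.measure_eq_iSup_isCompact]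
    refine iSup₂_le fun K _ => iSup_le fun hK => ?_
    obtain ⟨f, hf1, hfc, -, hf01⟩ :=
      exists_continuousMap_one_of_isCompact_subset_isOpen hK isOpen_univ (Set.subset_univ K)
    refine (RealRMK.rieszMeasure_le_of_eq_one Λ (f := ⟨f, hfc⟩) (fun x => (hf01 x).1) hK
      hf1).trans (ENNReal.ofReal_le_one.2 ?_)
    rw [hΛ]
    refine (Complex.re_le_norm _).trans ((φ.le_opNorm _).trans ?_)
    rw [hnorm, one_mul]
    refine S.norm_elt_one_le fun x => ?_
    change ‖((f x : ℝ) : ℂ)‖ ≤ 1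
    rw [Complex.norm_real, Real.norm_of_nonneg (hf01 x).1]
    exact (hf01 x).2
  have hYc : μ Yᶜ = 0 := by
    rw [hY.compl.isOpen.measure_eq_iSup_isCompact, ← le_zero_iff]
    refine iSup₂_le fun K hKY => iSup_le fun hK => ?_
    obtain ⟨f, hf1, hfc, hfs, hf01⟩ :=
      exists_continuousMap_one_of_isCompact_subset_isOpen hK hY.compl.isOpen hKY
    refine (RealRMK.rieszMeasure_le_of_eq_one Λ (f := ⟨f, hfc⟩) (fun x => (hf01 x).1) hK
      hf1).trans ?_
    have h0 : S.elt 1 (complexify ⟨f, hfc⟩) = S.elt 1 0 := by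
      refine S.elt_congr 1 fun x hx _ => ?_
      have : f x = 0 := by
        by_contra h
        exact hfs (subset_tsupport _ h) hx
      change ((f x : ℝ) : ℂ) = 0
      rw [this, Complex.ofReal_zero]
    rw [hΛ, h0]
    simp
  have hfin : IsFiniteMeasure μ := ⟨hmass.trans_lt ENNReal.one_lt_top⟩
  have hreal : ∀ f : C_c(X, ℝ), φ (S.elt 1 (complexify f)) = ((∫ x, f x ∂μ : ℝ) : ℂ) := by
    intro f
    have him : (φ (S.elt 1 (complexify f))).im = 0 := by
      have e : f = (f ⊔ 0) - ((-f) ⊔ 0) := by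
        ext x
        simp only [CompactlySupportedContinuousMap.sub_apply,
          CompactlySupportedContinuousMap.sup_apply, CompactlySupportedContinuousMap.neg_apply,
          CompactlySupportedContinuousMap.zero_apply]
        exact (max_zero_sub_max_neg_zero_eq_self (f x)).symm
      rw [e, map_sub, map_sub, map_sub, Complex.sub_im,
        ← (Complex.nonneg_iff.1 (S.apply_elt_one_nonneg hpos le_sup_right)).2,
        ← (Complex.nonneg_iff.1 (S.apply_elt_one_nonneg hpos le_sup_right)).2, sub_zero]
    rw [RealRMK.integral_rieszMeasure, hΛ]
    exact Complex.ext (by simp) (by simp [him])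
  refine ⟨μ, hμreg, hmass, hYc, fun F => ?_⟩
  set R := F.compLeft ⟨Complex.re, Complex.continuous_re⟩ with hR
  set J := F.compLeft ⟨Complex.im, Complex.continuous_im⟩ with hJ
  have hRx : ∀ x, R x = (F x).re := fun x =>
    CompactlySupportedContinuousMap.compLeft_apply Complex.zero_re F x
  have hJx : ∀ x, J x = (F x).im := fun x =>
    CompactlySupportedContinuousMap.compLeft_apply Complex.zero_im F x
  have hF : F = complexify R + Complex.I • complexify J := by
    ext x
    change F x = (R x : ℂ) + Complex.I * (J x : ℂ)
    rw [hRx, hJx, mul_comm, Complex.re_add_im]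
  have hint : Integrable F μ := F.continuous.integrable_of_hasCompactSupport F.hasCompactSupport
  calc φ (S.elt 1 F) = φ (S.elt 1 (complexify R)) + Complex.I * φ (S.elt 1 (complexify J)) := by
        conv_lhs => rw [hF]
        simp
    _ = ((∫ x, (F x).re ∂μ : ℝ) : ℂ) + ((∫ x, (F x).im ∂μ : ℝ) : ℂ) * Complex.I := by
        rw [hreal, hreal]
        simp only [hRx, hJx]
        rw [mul_comm]
    _ = ∫ x, F x ∂μ := integral_re_add_im hint

end SliceSystem

theorem exists_eq_one_on_isCompact {X : Type*} [TopologicalSpace X] [T2Space X]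
    [LocallyCompactSpace X] {K : Set X} (hK : IsCompact K) {U : Set X}
    (hU : IsOpen U) (hKU : K ⊆ U) : ∃ χ : C_c(X, ℝ), (∀ x ∈ K, χ x = 1) ∧ tsupport χ ⊆ U ∧
      ∀ x, χ x ∈ Set.Icc (0 : ℝ) 1 := by
  obtain ⟨f, hf1, hfc, hfs, hf01⟩ := exists_continuousMap_one_of_isCompact_subset_isOpen hK hU hKU
  exact ⟨⟨f, hfc⟩, hf1, hfs, hf01⟩

namespace SliceSystem

variable {G X : Type*} [Group G] [TopologicalSpace X] [T2Space X] [MulAction G X]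
    [ContinuousConstSMul G X] {Y : Set X} {hY : IsClopen Y} {N : G →* {r : ℝ // 0 < r}}
    {A : Type*} [NonUnitalCStarAlgebra A] (S : SliceSystem hY N A)

variable {φ : A →L[ℂ] ℂ} {β : ℝ}

theorem apply_elt_mul (hφ : IsKMSState (fun t a => S.dyn t a) β φ) (g : G) (F : C_c(X, ℂ))
    (b : A) : φ (S.elt g F * b) = (((N g : ℝ) ^ (-β) : ℝ) : ℂ) * φ (b * S.elt g F) :=
  hφ.apply_mul_of_eigenvector S.dyn_zero S.dyn_add (N g).2 (fun t => S.dyn_elt t g F) b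

variable [LocallyCompactSpace X]

/-- `φ(u_g F) = 0` if `F` is supported in a set that `g` moves off itself: with `H = 1` on the
support of `F`, `u_g F = (u_g F) H`, whereas `H (u_g F) = 0`. -/
theorem apply_elt_eq_zero_of_disjoint (hφ : IsKMSState (fun t a => S.dyn t a) β φ) {g : G}
    {V : Set X} (hV : IsOpen V) (hgV : ∀ x ∈ V, g • x ∉ V) {F : C_c(X, ℂ)}
    (hF : tsupport F ⊆ V) : φ (S.elt g F) = 0 := by
  obtain ⟨χ, hχ1, hχs, -⟩ := exists_eq_one_on_isCompact F.hasCompactSupport hV hF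
  have h1 : S.elt g F = S.elt g F * S.elt 1 (complexify χ) := by
    rw [elt_one_mul_elt]
    congr 1
    ext x
    by_cases hx : x ∈ tsupport F
    · simp [complexify_apply, hχ1 x hx]
    · simp [image_eq_zero_of_notMem_tsupport hx]
  have h2 : S.elt 1 (complexify χ) * S.elt g F = 0 := by
    rw [S.elt_mul, ← map_zero (S.elt (1 * g))]
    refine S.elt_congr _ fun x _ _ => ?_
    rw [sliceMul_apply]
    by_cases hx : x ∈ tsupport F
    · have h3 : χ (g • x) = 0 := by
        by_contra h
        exact hgV x (hF hx) (hχs (subset_tsupport _ h))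
      simp [Set.indicator_apply_eq_zero.2 fun _ => (by simp [complexify_apply, h3] :
        complexify χ (g • x) = 0)]
    · simp [image_eq_zero_of_notMem_tsupport hx]
  have h3 := S.apply_elt_mul hφ 1 (complexify χ) (S.elt g F)
  rw [h2, map_zero, ← h1] at h3
  simpa using h3.symm

/-- `φ(u_g F) = 0` if `g` has no fixed points in the support of `F`, by a partition of unity. -/
theorem apply_elt_eq_zero_of_forall_ne (hφ : IsKMSState (fun t a => S.dyn t a) β φ) {g : G}
    {F : C_c(X, ℂ)} (hF : ∀ x ∈ tsupport F, g • x ≠ x) : φ (S.elt g F) = 0 := by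
  have hV : ∀ x ∈ tsupport F, ∃ V : Set X, IsOpen V ∧ x ∈ V ∧ ∀ y ∈ V, g • y ∉ V := by
    intro x hx
    obtain ⟨U₁, U₂, h₁, h₂, m₁, m₂, hd⟩ := t2_separation (hF x hx)
    refine ⟨U₂ ∩ (fun y => g • y) ⁻¹' U₁, h₂.inter (h₁.preimage (continuous_const_smul g)),
      ⟨m₂, m₁⟩, fun y hy hgy => Set.disjoint_left.1 hd hy.2 hgy.1⟩
  choose! V hVo hxV hgV using hV
  obtain ⟨t, ht, hcover⟩ := F.hasCompactSupport.elim_nhds_subcover V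
    fun x hx => (hVo x hx).mem_nhds (hxV x hx)
  let e := t.equivFin.symm
  obtain ⟨χ, hχs, hχ1, -, hχc⟩ := exists_continuous_sum_one_of_isOpen_isCompact
    (s := fun i => V (e i)) (fun i => hVo _ (ht _ (e i).2)) F.hasCompactSupport (by
      intro x hx
      obtain ⟨y, hy, hxy⟩ := Set.mem_iUnion₂.1 (hcover hx)
      exact Set.mem_iUnion.2 ⟨t.equivFin ⟨y, hy⟩, by simpa [e] using hxy⟩)
  have hsum : F = ∑ i, F * complexify ⟨χ i, hχc i⟩ := by
    ext x
    rw [CompactlySupportedContinuousMap.sum_apply]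
    simp only [CompactlySupportedContinuousMap.mul_apply]
    rw [← Finset.mul_sum]
    by_cases hx : x ∈ tsupport F
    · have h1 : ∑ i, χ i x = 1 := by simpa using hχ1 hx
      have h2 : ∑ i, complexify ⟨χ i, hχc i⟩ x = 1 := by
        change ∑ i, ((χ i x : ℝ) : ℂ) = 1
        rw [← Complex.ofReal_sum, h1, Complex.ofReal_one]
      rw [h2, mul_one]
    · rw [image_eq_zero_of_notMem_tsupport hx, zero_mul]
  rw [hsum, map_sum, map_sum]
  refine Finset.sum_eq_zero fun i _ => ?_
  refine S.apply_elt_eq_zero_of_disjoint hφ (hVo _ (ht _ (e i).2)) (hgV _ (ht _ (e i).2))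
    (Set.Subset.trans ?_ (hχs i))
  refine closure_mono fun x hx => ?_
  simp only [Function.mem_support, CompactlySupportedContinuousMap.mul_apply, ne_eq, mul_eq_zero,
    not_or] at hx
  exact fun h => hx.2 (by change ((χ i x : ℝ) : ℂ) = 0; rw [h, Complex.ofReal_zero])

variable [MeasurableSpace X] [BorelSpace X]

/-- `φ(u_g F) = 0` if the fixed points of `g` form a null set: by the previous lemma only the part
of `F` near the fixed points contributes, and `|φ(u_g F)|² ≤ C ∫ |F|² dμ` by Cauchy–Schwarz. -/
theorem apply_elt_eq_zero_of_null (hφ : IsKMSState (fun t a => S.dyn t a) β φ) {μ : Measure X}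
    [μ.Regular] (hμ : ∀ F : C_c(X, ℂ), φ (S.elt 1 F) = ∫ x, F x ∂μ) {g : G}
    (hg : μ {x | g • x = x} = 0) (F : C_c(X, ℂ)) : φ (S.elt g F) = 0 := by
  obtain ⟨χ₁, hχ₁, -, -⟩ := exists_eq_one_on_isCompact F.hasCompactSupport isOpen_univ
    (Set.subset_univ _)
  set a := star (S.elt g (complexify χ₁)) with ha
  set C := (φ (star a * a)).re with hC
  have hC0 : 0 ≤ C := (Complex.nonneg_iff.1 (hφ.1.1 a)).1
  obtain ⟨M, hM⟩ := F.continuous.bounded_above_of_compact_support F.hasCompactSupport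
  have hbound : ∀ ε : ℝ, 0 < ε → ‖φ (S.elt g F)‖ ^ 2 ≤ C * M ^ 2 * ε := by
    intro ε hε
    obtain ⟨U, hUF, hU, hUε⟩ := Set.exists_isOpen_lt_of_lt {x | g • x = x} (ENNReal.ofReal ε)
      (by rw [hg]; exact ENNReal.ofReal_pos.2 hε)
    have hFix : IsClosed {x : X | g • x = x} := isClosed_eq (continuous_const_smul g) continuous_id
    obtain ⟨K, hK, hKint, hKU⟩ := exists_compact_between
      (F.hasCompactSupport.inter_right hFix : IsCompact (tsupport F ∩ {x : X | g • x = x})) hU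
      (Set.inter_subset_right.trans hUF)
    obtain ⟨χ, hχ1, hχs, hχ01⟩ := exists_eq_one_on_isCompact hK hU hKU
    have h0 : φ (S.elt g (F - F * complexify χ)) = 0 := by
      refine S.apply_elt_eq_zero_of_forall_ne hφ fun x hx hfix => ?_
      have hxF : x ∈ tsupport F := by
        refine closure_mono (fun y hy => ?_) hx
        contrapose! hy
        simp only [Function.mem_support, not_not] at hy ⊢
        simp [hy]
      refine (notMem_tsupport_iff_eventuallyEq.2 ?_) hx
      filter_upwards [isOpen_interior.mem_nhds (hKint ⟨hxF, hfix⟩)] with y hy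
      simp [complexify_apply, hχ1 y (interior_subset hy)]
    set F' := F * complexify χ with hF'
    have e1 : φ (S.elt g F) = φ (star a * S.elt 1 F') := by
      have : S.elt g F = S.elt g (F - F') + S.elt g F' := by rw [← map_add, sub_add_cancel]
      rw [this, map_add, h0, zero_add, ha, star_star, elt_one_mul_elt]
      congr 2
      ext x
      by_cases hx : x ∈ tsupport F
      · simp [complexify_apply, hχ₁ x hx]
      · simp [hF', image_eq_zero_of_notMem_tsupport hx]
    have e2 : (φ (star (S.elt 1 F') * S.elt 1 F')).re ≤ M ^ 2 * ε := by
      rw [star_elt_one, elt_one_mul_elt, hμ]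
      have hUfin : μ U ≠ ∞ := (hUε.trans ENNReal.ofReal_lt_top).ne
      calc _ ≤ ‖∫ x, (star F' * F') x ∂μ‖ := Complex.re_le_norm _
        _ ≤ ∫ x, U.indicator (fun _ => M ^ 2) x ∂μ := by
            refine norm_integral_le_of_norm_le
              ((integrable_indicator_iff hU.measurableSet).2 (integrableOn_const hUfin))
              (Filter.Eventually.of_forall fun x => ?_)
            simp only [CompactlySupportedContinuousMap.mul_apply,
              CompactlySupportedContinuousMap.star_apply, norm_mul, norm_star, hF',
              complexify_apply, Complex.norm_real]
            by_cases hx : x ∈ U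
            · rw [Set.indicator_of_mem hx, Real.norm_of_nonneg (hχ01 x).1]
              have h1 : ‖F x‖ * χ x ≤ M :=
                (mul_le_of_le_one_right (norm_nonneg _) (hχ01 x).2).trans (hM x)
              have h2 : 0 ≤ ‖F x‖ * χ x := mul_nonneg (norm_nonneg _) (hχ01 x).1
              nlinarith
            · have : χ x = 0 := by
                by_contra h
                exact hx (hχs (subset_tsupport _ h))
              rw [Set.indicator_of_notMem hx, this]
              simp
        _ = (μ U).toReal * M ^ 2 := by
            rw [integral_indicator hU.measurableSet]
            simp [Measure.real]
        _ ≤ ε * M ^ 2 := by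
            gcongr
            exact ENNReal.toReal_le_of_le_ofReal hε.le hUε.le
        _ = _ := mul_comm _ _
    rw [e1]
    calc _ ≤ C * (φ (star (S.elt 1 F') * S.elt 1 F')).re :=
          norm_sq_apply_star_mul_le hφ.1.1 a _
      _ ≤ C * (M ^ 2 * ε) := by gcongr
      _ = _ := by ring
  have hsq : ‖φ (S.elt g F)‖ ^ 2 ≤ 0 := by
    refine le_of_forall_pos_le_add fun ε hε => ?_
    have h := hbound (ε / (C * M ^ 2 + 1)) (by positivity)
    refine h.trans ?_
    rw [zero_add, mul_div_assoc', div_le_iff₀ (by positivity)]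
    nlinarith
  exact norm_eq_zero.1 (pow_eq_zero_iff two_ne_zero |>.1 (le_antisymm hsq (sq_nonneg _)))

/-- The KMS relation for `u_g F` and `u_{g⁻¹} H` says that the measure on `Y` given by a KMS state
scales under the partial action of `G` on `Y`. -/
theorem measure_smul_of_isKMSState [SecondCountableTopology X]
    (hφ : IsKMSState (fun t a => S.dyn t a) β φ) {μ : Measure X} [IsFiniteMeasure μ]
    (hμ : ∀ F : C_c(X, ℂ), φ (S.elt 1 F) = ∫ x, F x ∂μ) (g : G) {Z : Set X}
    (hZ : MeasurableSet Z) (hZY : Z ⊆ Y) (hgZ : g • Z ⊆ Y) :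
    μ (g • Z) = scaleHom N β g * μ Z := by
  have hYm : MeasurableSet Y := hY.isOpen.measurableSet
  have hWm : MeasurableSet (g⁻¹ • Y) := hYm.const_smul g⁻¹
  have hr : 0 ≤ (N g : ℝ) ^ (-β) := Real.rpow_nonneg (N g).2.le _
  have : IsFiniteMeasure (scaleHom N β g • μ.restrict (g⁻¹ • Y)) := by
    rw [scaleHom_apply]
    exact Measure.smul_finite _ ENNReal.ofReal_ne_top
  have hν : (μ.map fun x => g⁻¹ • x).restrict Y = scaleHom N β g • μ.restrict (g⁻¹ • Y) := by
    refine Measure.ext_of_integral_eq_on_compactlySupported fun f => ?_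
    -- With `h = 1` on `g • tsupport f`, the coefficients of the two products of `u_g f` and
    -- `u_{g⁻¹} h` no longer involve `h`.
    obtain ⟨h, hh, -, -⟩ := exists_eq_one_on_isCompact
      (f.hasCompactSupport.image (continuous_const_smul g)) isOpen_univ (Set.subset_univ _)
    have hkms := S.apply_elt_mul hφ g (complexify f) (S.elt g⁻¹ (complexify h))
    rw [S.elt_mul, S.elt_mul, mul_inv_cancel, inv_mul_cancel, hμ, hμ] at hkms
    have e1 : ∀ y, sliceMul hY (complexify f) g⁻¹ (complexify h) y
        = ((Y.indicator f (g⁻¹ • y) : ℝ) : ℂ) := by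
      intro y
      rw [sliceMul_apply]
      by_cases hy : g⁻¹ • y ∈ Y
      · rw [Set.indicator_of_mem hy, Set.indicator_of_mem hy, complexify_apply, complexify_apply]
        by_cases hf : g⁻¹ • y ∈ tsupport f
        · rw [hh y ⟨_, hf, smul_inv_smul g y⟩]
          simp
        · simp [image_eq_zero_of_notMem_tsupport hf]
      · simp [Set.indicator_of_notMem hy]
    have e2 : ∀ y, sliceMul hY (complexify h) g (complexify f) y
        = (((g⁻¹ • Y).indicator f y : ℝ) : ℂ) := by
      intro y
      rw [sliceMul_apply]
      by_cases hy : g • y ∈ Y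
      · rw [Set.indicator_of_mem hy, Set.indicator_of_mem (Set.mem_inv_smul_set_iff.2 hy),
          complexify_apply, complexify_apply]
        by_cases hf : y ∈ tsupport f
        · rw [hh _ ⟨y, hf, rfl⟩]
          simp
        · simp [image_eq_zero_of_notMem_tsupport hf]
      · rw [Set.indicator_of_notMem hy,
          Set.indicator_of_notMem fun hy' => hy (Set.mem_inv_smul_set_iff.1 hy')]
        simp
    simp only [e1, e2] at hkms
    rw [integral_complex_ofReal, integral_complex_ofReal, ← Complex.ofReal_mul,
      Complex.ofReal_inj] at hkms
    rw [← integral_indicator hYm, (measurableEmbedding_const_smul g⁻¹).integral_map, hkms,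
      integral_smul_measure, integral_indicator hWm, scaleHom_apply, ENNReal.toReal_ofReal hr,
      smul_eq_mul]
  have h := congrArg (fun m : Measure X => m Z) hν
  simp only [Measure.smul_apply, Measure.restrict_apply hZ, smul_eq_mul] at h
  rwa [Set.inter_eq_self_of_subset_left hZY,
    Set.inter_eq_self_of_subset_left (Set.subset_smul_set_iff.2 (by rwa [inv_inv])),
    Measure.map_apply (measurable_const_smul _) hZ, Set.preimage_smul, inv_inv] at h

end SliceSystem

/-! ### The bijection -/

theorem IsNormalizedScalingMeasure.measure_smul {G X : Type*} [Group G] [TopologicalSpace X]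
    [MeasurableSpace X] [MulAction G X] {Y : Set X} {N : G →* {r : ℝ // 0 < r}} {β : ℝ}
    {μ : Measure X} (hμ : IsNormalizedScalingMeasure Y N β μ) (g : G) (Z : Set X)
    (hZ : MeasurableSet Z) : μ (g • Z) = scaleHom N β g * μ Z :=
  hμ.scaling g Z hZ

theorem IsNormalizedScalingMeasure.isProbabilityMeasure_comap {G X : Type*} [Group G]
    [TopologicalSpace X] [MeasurableSpace X] [MulAction G X] {Y : Set X}
    {N : G →* {r : ℝ // 0 < r}} {β : ℝ} {μ : Measure X}
    (hμ : IsNormalizedScalingMeasure Y N β μ) (hY : MeasurableSet Y) :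
    IsProbabilityMeasure (μ.comap ((↑) : Y → X)) :=
  ⟨(comap_subtype_val_univ μ hY).trans hμ.normalized⟩

/-- The scaling factor forces sets that are invariant under an element with `N(g) ≠ 1` to be null
sets. -/
theorem measure_eq_zero_of_smul_eq {G X : Type*} [Group G] [MeasurableSpace X] [MulAction G X]
    {N : G →* {r : ℝ // 0 < r}} {β : ℝ} (hβ : β ≠ 0) {μ : Measure X} [IsFiniteMeasure μ] {g : G}
    (hg : (N g : ℝ) ≠ 1) {Z : Set X} (hZ : g • Z = Z)
    (hμ : μ (g • Z) = scaleHom N β g * μ Z) : μ Z = 0 := by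
  by_contra h0
  rw [hZ] at hμ
  have h1 : scaleHom N β g = 1 := by
    refine ((ENNReal.mul_left_inj h0 (measure_ne_top μ Z)).1 ?_).symm
    rw [one_mul]
    exact hμ
  rw [scaleHom_apply, ENNReal.ofReal_eq_one] at h1
  exact hg ((Real.rpow_left_inj (N g).2.le zero_le_one (neg_ne_zero.2 hβ)).1
    (h1.trans (Real.one_rpow _).symm))

namespace SliceSystem

variable {G X : Type*} [Group G] [Countable G] [TopologicalSpace X] [SecondCountableTopology X]
    [LocallyCompactSpace X] [T2Space X] [MeasurableSpace X] [BorelSpace X] [MulAction G X]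
    [ContinuousConstSMul G X] {Y : Set X} {hY : IsClopen Y} {N : G →* {r : ℝ // 0 < r}}
    {A : Type*} [NonUnitalCStarAlgebra A] (S : SliceSystem hY N A)

/-- Every KMS state comes from a scaling measure if the points of `Y` with nontrivial isotropy are
covered by sets that are invariant under elements `g` with `N(g) ≠ 1`. -/
theorem exists_scalingMeasure_of_isKMSState (hGY : ⋃ g : G, g • Y = Set.univ)
    {Yn : ℕ → Set X} {gn : ℕ → G} (hYn_meas : ∀ n, MeasurableSet (Yn n)) (hYn_sub : ∀ n, Yn n ⊆ Y)
    (h_cover : {y ∈ Y | MulAction.stabilizer G y ≠ ⊥} ⊆ ⋃ n, Yn n)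
    (h_ne : ∀ n, (N (gn n) : ℝ) ≠ 1) (h_inv : ∀ n, gn n • Yn n = Yn n)
    {β : ℝ} (hβ : β ≠ 0) {φ : A →L[ℂ] ℂ} (hφ : IsKMSState (fun t a => S.dyn t a) β φ) :
    ∃ μ : Measure X, IsNormalizedScalingMeasure Y N β μ ∧
      ∀ a, φ a = ∫ x : Y, S.expect a x ∂(μ.comap ((↑) : Y → X)) := by
  have hYm : MeasurableSet Y := hY.isOpen.measurableSet
  obtain ⟨μ₀, hreg, hmass, hYc, hint⟩ := S.exists_measure_of_state hφ.1
  have hfin : IsFiniteMeasure μ₀ := ⟨hmass.trans_lt ENNReal.one_lt_top⟩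
  have hpart : ∀ (g : G) (Z : Set X), MeasurableSet Z → Z ⊆ Y → g • Z ⊆ Y →
      μ₀ (g • Z) = scaleHom N β g * μ₀ Z := fun g Z hZ hZY hgZ =>
    S.measure_smul_of_isKMSState hφ hint g hZ hZY hgZ
  have hnull : ∀ g : G, g ≠ 1 → μ₀ {x | g • x = x} = 0 := by
    intro g hg
    have hYn : μ₀ (⋃ n, Yn n) = 0 := measure_iUnion_null fun n =>
      measure_eq_zero_of_smul_eq hβ (h_ne n) (h_inv n)
        (hpart _ _ (hYn_meas n) (hYn_sub n) ((h_inv n).trans_subset (hYn_sub n)))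
    refine measure_mono_null (fun x hx => ?_) (measure_union_null hYn hYc)
    by_cases hxY : x ∈ Y
    · refine Or.inl (h_cover ⟨hxY, fun hbot => hg ?_⟩)
      have : g ∈ MulAction.stabilizer G x := hx
      rwa [hbot, Subgroup.mem_bot] at this
    · exact Or.inr hxY
  have hfin' : IsFiniteMeasure (μ₀.comap ((↑) : Y → X)) :=
    ⟨(comap_subtype_val_univ μ₀ hYm).trans_lt (measure_lt_top μ₀ Y)⟩
  have hrestrict : μ₀.restrict Y = μ₀ := Measure.restrict_eq_self_of_ae_mem hYc
  have hφeq : φ = S.integralFunctional (μ₀.comap ((↑) : Y → X)) := by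
    refine S.clm_ext fun g F => ?_
    by_cases hg : g = 1
    · rw [hg, hint, integralFunctional_elt_one, hrestrict]
    · rw [S.apply_elt_eq_zero_of_null hφ hint (hnull g hg), S.integralFunctional_elt_of_ne _ hg]
  have hμ₀Y : μ₀ Y = 1 := by
    refine le_antisymm ((measure_mono (Set.subset_univ Y)).trans hmass) ?_
    have h1 := S.norm_integralFunctional_le (μ₀.comap ((↑) : Y → X))
    rw [← hφeq, hφ.1.2, Measure.real, comap_subtype_val_univ μ₀ hYm] at h1
    rw [← ENNReal.ofReal_toReal (measure_ne_top μ₀ Y)]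
    exact ENNReal.one_le_ofReal.2 h1
  obtain ⟨μ, hμ, hscale⟩ := exists_scaling_extension hYm hGY hpart
  have hμY : μ Y = 1 := (hμ Y subset_rfl hYm).trans hμ₀Y
  have hlf : IsLocallyFiniteMeasure μ :=
    isLocallyFiniteMeasure_of_scaling hY hYm hGY (by simp [hμY]) hscale
  refine ⟨μ, ⟨inferInstance, hμY, hscale⟩, fun a => ?_⟩
  have hcomap : μ.comap ((↑) : Y → X) = μ₀.comap ((↑) : Y → X) := by
    ext Z hZ
    rw [comap_subtype_coe_apply hYm, comap_subtype_coe_apply hYm]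
    exact hμ _ (Subtype.coe_image_subset Y Z) (hYm.subtype_image hZ)
  rw [hcomap, hφeq]
  rfl

end SliceSystem

theorem IsNormalizedScalingMeasure.convexComb {G X : Type*} [Group G] [TopologicalSpace X]
    [SecondCountableTopology X] [LocallyCompactSpace X] [T2Space X] [MeasurableSpace X]
    [BorelSpace X] [MulAction G X] {Y : Set X} {N : G →* {r : ℝ // 0 < r}} {β : ℝ}
    {μ ν : Measure X} (hμ : IsNormalizedScalingMeasure Y N β μ)
    (hν : IsNormalizedScalingMeasure Y N β ν) {s t : NNReal} (hst : s + t = 1) :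
    IsNormalizedScalingMeasure Y N β (s • μ + t • ν) := by
  have := hμ.radon
  have := hν.radon
  have hlf : IsFiniteMeasureOnCompacts (s • μ + t • ν) := ⟨fun K hK => by
    rw [Measure.add_apply, Measure.smul_apply, Measure.smul_apply]
    exact ENNReal.add_lt_top.2 ⟨ENNReal.mul_lt_top ENNReal.coe_lt_top hK.measure_lt_top,
      ENNReal.mul_lt_top ENNReal.coe_lt_top hK.measure_lt_top⟩⟩
  have hlf' : IsLocallyFiniteMeasure (s • μ + t • ν) :=
    isLocallyFiniteMeasure_of_isFiniteMeasureOnCompacts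
  refine ⟨inferInstance, ?_, fun g Z hZ => ?_⟩
  · rw [Measure.add_apply, Measure.smul_apply, Measure.smul_apply, hμ.normalized, hν.normalized]
    simp only [ENNReal.smul_def, smul_eq_mul, mul_one]
    exact_mod_cast hst
  · simp only [Measure.add_apply, Measure.smul_apply, hμ.scaling g Z hZ, hν.scaling g Z hZ,
      ENNReal.smul_def, smul_eq_mul]
    ring

end Classification

open scoped Pointwise NNReal in
theorem proposition1p1
    {G X : Type*} [Group G] [Countable G] [TopologicalSpace G] [DiscreteTopology G]
    [TopologicalSpace X] [SecondCountableTopology X] [LocallyCompactSpace X] [T2Space X]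
    [MeasurableSpace X] [BorelSpace X] [MulAction G X] [ContinuousConstSMul G X]
    (Y : Set X) (hY : IsClopen Y) (hGY : ⋃ g : G, g • Y = Set.univ)
    (N : G →* {r : ℝ // 0 < r})
    (Yn : ℕ → Set X) (gn : ℕ → G)
    (hYn_meas : ∀ n, MeasurableSet (Yn n)) (hYn_sub : ∀ n, Yn n ⊆ Y)
    (h_cover : {y ∈ Y | MulAction.stabilizer G y ≠ ⊥} ⊆ ⋃ n, Yn n)
    (h_ne : ∀ n, (N (gn n) : ℝ) ≠ 1)
    (h_inv : ∀ n, gn n • Yn n = Yn n)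
    (β : ℝ) (hβ : β ≠ 0) :
    ∃ Φ : {μ : MeasureTheory.Measure X // IsNormalizedScalingMeasure Y N β μ} ≃
        {φ : ReducedCStar G Y →L[ℂ] ℂ // IsKMSState (fun t a => dynamics Y N t a) β φ},
      (∀ μ (a : ReducedCStar G Y),
        MeasureTheory.Integrable (condExpect a) (μ.1.comap ((↑) : Y → X)) ∧
        (Φ μ).1 a = ∫ x : Y, condExpect a x ∂(μ.1.comap ((↑) : Y → X))) ∧
      ∀ (s t : ℝ≥0), s + t = 1 → ∀ μ ν,
        ∃ h : IsNormalizedScalingMeasure Y N β (s • μ.1 + t • ν.1),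
          (Φ ⟨s • μ.1 + t • ν.1, h⟩).1 = (s : ℂ) • (Φ μ).1 + (t : ℂ) • (Φ ν).1 := by
  have hYm : MeasurableSet Y := hY.isOpen.measurableSet
  let S := reducedSliceSystem (G := G) hY N
  have hprob : ∀ μ : {μ : MeasureTheory.Measure X // IsNormalizedScalingMeasure Y N β μ},
      MeasureTheory.IsProbabilityMeasure (μ.1.comap ((↑) : Y → X)) :=
    fun μ => μ.2.isProbabilityMeasure_comap hYm
  let f : {μ : MeasureTheory.Measure X // IsNormalizedScalingMeasure Y N β μ} →
      {φ : ReducedCStar G Y →L[ℂ] ℂ // IsKMSState (fun t a => dynamics Y N t a) β φ} := fun μ =>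
    haveI := hprob μ
    haveI := μ.2.radon
    ⟨S.integralFunctional (μ.1.comap ((↑) : Y → X)),
      S.isKMSState_integralFunctional μ.2.normalized μ.2.measure_smul⟩
  have hf : ∀ μ a, (f μ).1 a = ∫ x : Y, condExpect a x ∂(μ.1.comap ((↑) : Y → X)) :=
    fun μ a => rfl
  have hinj : Function.Injective f := by
    intro μ ν h
    have := hprob μ
    have := hprob ν
    exact Subtype.ext (S.eq_of_integralFunctional_eq hGY μ.2.normalized ν.2.normalized
      μ.2.measure_smul ν.2.measure_smul (congrArg Subtype.val h))
  have hsurj : Function.Surjective f := by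
    intro φ
    obtain ⟨μ, hμ, h⟩ := S.exists_scalingMeasure_of_isKMSState hGY hYn_meas hYn_sub h_cover h_ne
      h_inv hβ φ.2
    exact ⟨⟨μ, hμ⟩, Subtype.ext (ContinuousLinearMap.ext fun a => (h a).symm)⟩
  have hintegrable : ∀ (μ : {μ : MeasureTheory.Measure X // IsNormalizedScalingMeasure Y N β μ})
      (a : ReducedCStar G Y), MeasureTheory.Integrable (condExpect a) (μ.1.comap ((↑) : Y → X)) := fun μ a =>
    haveI := hprob μ
    S.integrable_expect _ a
  refine ⟨Equiv.ofBijective f ⟨hinj, hsurj⟩, fun μ a => ⟨hintegrable μ a, hf μ a⟩,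
    fun s t hst μ ν => ⟨μ.2.convexComb ν.2 hst, ?_⟩⟩
  refine ContinuousLinearMap.ext fun a => ?_
  change ∫ x : Y, condExpect a x ∂((s • μ.1 + t • ν.1).comap ((↑) : Y → X))
    = (s : ℂ) * ∫ x : Y, condExpect a x ∂(μ.1.comap ((↑) : Y → X))
      + (t : ℂ) * ∫ x : Y, condExpect a x ∂(ν.1.comap ((↑) : Y → X))
  have hcomap : (s • μ.1 + t • ν.1).comap ((↑) : Y → X)
      = s • μ.1.comap ((↑) : Y → X) + t • ν.1.comap ((↑) : Y → X) := by
    ext Z hZ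
    simp only [MeasureTheory.Measure.add_apply, MeasureTheory.Measure.smul_apply,
      comap_subtype_coe_apply hYm]
  rw [hcomap, MeasureTheory.integral_add_measure ((hintegrable μ a).smul_measure_nnreal)
    ((hintegrable ν a).smul_measure_nnreal), MeasureTheory.integral_smul_nnreal_measure,
    MeasureTheory.integral_smul_nnreal_measure]
  rfl
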